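/- Let $\{W(t):t\ge 0\}$ be a standard Wiener process, let $\gamma>-\tfrac12$ and put $\nu=\frac{1}{2(1+\gamma)}$, so that $0<\nu<1$. For real $\rho$ and $x>0$ let $$J_\rho(x)=\left(\tfrac{x}{2}\right)^{\rho}\sum_{k=0}^{\infty}\frac{(-\frac14x^2)^k}{\Gamma(\rho+k+1)\Gamma(k+1)}$$ be the Bessel function of the first kind. The positive zeros of $J_\nu$ form an infinite increasing sequence $0<z_{\nu,1}<z_{\nu,2}<\cdots$. For $t\in[0,1]$ let $$W_\gamma(t)=\frac{1}{\sqrt{1+2\gamma}}\left\{W(t^{1+2\gamma})-\int_0^1W(u^{1+2\gamma})\,du\right\},$$ and for $k\ge1$ let $$\lambda_k=\left\{\frac{2\nu}{z_{\nu,k}}\right\}^2,\qquad e_k(t)=t^{\frac1{2\nu}-\frac12}\,\frac{J_{\nu-1}\bigl(z_{\nu,k}\,t^{\frac1{2\nu}}\bigr)}{\sqrt\nu\,J_{\nu-1}(z_{\nu,k})}\quad(0<t\le1),$$ where $e_k$ extends continuously to $t=0$. Then $W_\gamma$ is a centered Gaussian process on $[0,1]$ whose covariance function $K(s,t)=\mathbb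 E(W_\gamma(s)W_\gamma(t))$ is in $L^2([0,1]^2)$, and its Karhunen–Loève expansion is $$W_\gamma(t)\stackrel{\text{law}}{=}\sum_{k=1}^\infty\omega_k\sqrt{\lambda_k}\,e_k(t),\qquad t\in[0,1],$$ with $\omega_1,\omega_2,\dots$ i.i.d. $N(0,1)$. That is: (i) the $e_k$ are orthonormal in $L^2([0,1])$; $\lambda_1\ge\lambda_2\ge\cdots\ge 0$; and $\int_0^1K(s,t)e_k(s)\,ds=\lambda_ke_k(t)$ for all $k\ge1$ and $t\in[0,1]$; (ii) the $\lambda_k$ are all the nonzero eigenvalues, with multiplicity, of the operator $h\mapsto\int_0^1K(s,\cdot)h(s)\,ds$ on $L^2([0,1])$: no eigenfunction of a nonzero eigenvalue is orthogonal to every $e_k$; (iii) for every i.i.d. $N(0,1)$ sequence $(\omega_k)$ the series converges in mean square for each $t\in[0,1]$, and its sum has the same finite-dimensional distributions as $W_\gamma$ on $[0,1]$. -/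

import Mathlib

open MeasureTheory ProbabilityTheory Filter Set
open scoped NNReal Topology

universe u v

/-- The Bessel function of the first kind of real index `ν`, at `x > 0`. (Here `Real.Gamma` is `0`
at its poles, so that the corresponding terms vanish, as they should.) -/
noncomputable def besselJ (ν x : ℝ) : ℝ :=
  (x / 2) ^ ν *
    ∑' k : ℕ, (-(x ^ 2) / 4) ^ k / (Real.Gamma (ν + k + 1) * Real.Gamma ((k : ℝ) + 1))

/-- The positive zeros of `J_ν` in increasing order, numbered from `0`:
`besselZero ν k` is `z_{ν,k+1}`. -/
noncomputable def besselZero (ν : ℝ) : ℕ → ℝ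
  | 0 => sInf {x | 0 < x ∧ besselJ ν x = 0}
  | k + 1 => sInf {x | besselZero ν k < x ∧ besselJ ν x = 0}

/-- The weighted mean-centered Wiener process
`W_γ(t) = (1+2γ)^{-1/2} {W(t^{1+2γ}) - ∫_0^1 W(u^{1+2γ}) du}`, for `t ∈ [0,1]`. -/
noncomputable def weightedMeanCentered {Ω : Type u} (W : ℝ≥0 → Ω → ℝ) (γ t : ℝ) (ω : Ω) : ℝ :=
  (1 / √(1 + 2 * γ)) *
    (W (t ^ (1 + 2 * γ)).toNNReal ω - ∫ u in (0 : ℝ)..1, W (u ^ (1 + 2 * γ)).toNNReal ω)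

/-- The covariance function `K(s,t) = E(X(s) X(t))` of a centered process. -/
noncomputable def covKernel {Ω : Type u} [MeasurableSpace Ω] (P : Measure Ω) (X : ℝ → Ω → ℝ)
    (s t : ℝ) : ℝ :=
  ∫ ω, X s ω * X t ω ∂P

/-- The Fredholm operator on `[0,1]` with kernel `K`: `(T h)(t) = ∫_{[0,1]} K(s,t) h(s) ds`. -/
noncomputable def fredholm (K : ℝ → ℝ → ℝ) (h : ℝ → ℝ) (t : ℝ) : ℝ :=
  ∫ s in Icc (0 : ℝ) 1, K s t * h s

/-- `h` is an eigenfunction of the Fredholm operator on `L²([0,1])` with kernel `K`, for the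
eigenvalue `μ`. Elements of `L²` are represented by functions, up to almost everywhere equality. -/
structure IsEigenpair (K : ℝ → ℝ → ℝ) (μ : ℝ) (h : ℝ → ℝ) : Prop where
  memLp : MemLp h 2 (volume.restrict (Icc (0 : ℝ) 1))
  ne_zero : ¬ h =ᵐ[volume.restrict (Icc (0 : ℝ) 1)] 0
  eigen : fredholm K h =ᵐ[volume.restrict (Icc (0 : ℝ) 1)] fun t => μ * h t

/-- The process `X` on `[0,1]` is a centered Gaussian process with square-integrable covariance
function whose Karhunen–Loève expansion is `X(t) = ∑_k ω_k √λ_k e_k(t)` in law. -/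
structure IsKLExpansion {Ω : Type u} [MeasurableSpace Ω] (P : Measure Ω) (X : ℝ → Ω → ℝ)
    (lam : ℕ → ℝ) (e : ℕ → ℝ → ℝ) : Prop where
  gaussian : IsGaussianProcess (fun t : Icc (0 : ℝ) 1 => X t) P
  centered : ∀ t ∈ Icc (0 : ℝ) 1, ∫ ω, X t ω ∂P = 0
  cov_memLp : MemLp (fun p : ℝ × ℝ => covKernel P X p.1 p.2) 2
    (volume.restrict (Icc (0 : ℝ) 1 ×ˢ Icc (0 : ℝ) 1))
  antitone : Antitone lam
  nonneg : ∀ k, 0 ≤ lam k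
  /-- Each `e_k` is an eigenfunction for `λ_k`. -/
  eigenpair : ∀ k, IsEigenpair (covKernel P X) (lam k) (e k)
  /-- The eigenvalue equation of `e_k` holds at every point of `[0,1]`. -/
  eigen_eq : ∀ k, ∀ t ∈ Icc (0 : ℝ) 1, fredholm (covKernel P X) (e k) t = lam k * e k t
  /-- The `e_k` are orthonormal in `L²([0,1])`. -/
  orthonormal : ∀ k l, ∫ t in Icc (0 : ℝ) 1, e k t * e l t = if k = l then 1 else 0
  /-- The `λ_k` exhaust the nonzero eigenvalues, with multiplicity: no eigenfunction for a nonzero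
  eigenvalue is orthogonal to all the `e_k`. -/
  exhaust : ∀ (μ : ℝ) (h : ℝ → ℝ), μ ≠ 0 → IsEigenpair (covKernel P X) μ h →
    ∃ k, ∫ t in Icc (0 : ℝ) 1, h t * e k t ≠ 0
  /-- For i.i.d. standard normal `ω_k`, on any probability space, the series converges in mean
  square at every `t ∈ [0,1]`, and its sum `Y` has the law of `X` (equality of the
  finite-dimensional distributions). -/
  law : ∀ (Ω' : Type v) [MeasurableSpace Ω'] (P' : Measure Ω') [IsProbabilityMeasure P']
    (ξ : ℕ → Ω' → ℝ), iIndepFun ξ P' → (∀ k, HasLaw (ξ k) (gaussianReal 0 1) P') →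
    ∃ Y : ℝ → Ω' → ℝ,
      (∀ t ∈ Icc (0 : ℝ) 1, MemLp (Y t) 2 P' ∧
        Tendsto
          (fun n : ℕ => ∫ ω, (Y t ω - ∑ k ∈ Finset.range n, ξ k ω * √(lam k) * e k t) ^ 2 ∂P')
          atTop (𝓝 0)) ∧
      ∀ J : Finset ℝ, (J : Set ℝ) ⊆ Icc (0 : ℝ) 1 →
        IdentDistrib (fun ω (t : J) => X t ω) (fun ω (t : J) => Y t ω) P P'

/-! Put β = 1 + 2γ and q = β + 1 = 1/ν. As a curve in L²(P) the process has integral zero, and its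
covariance is min(s,t)^β/β + a(s) + a(t) for some continuous a. Since the kernel annihilates
constants, every eigenfunction h with nonzero eigenvalue μ has mean zero. The terms in a then
contribute only a constant to the eigenvalue equation, and differentiating it gives μ h'(t) =
-t^(q-2) ∫_0^t h. So U = ∫_0^t h and H = h solve U' = H, H' = -κ t^(q-2) U with κ = 1/μ and U(0) =
U(1) = 0. Conversely, such a pair gives an eigenfunction up to an additive constant, which vanishes
because all means are zero; hence a is never computed.

Write J_ν(x) = (x/2)^ν G_ν(x²) with G_ν entire. The relations G_ν' = -G_{ν+1}/4 and ν G_ν + y G_ν' =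
G_{ν-1} show that U = ν t G_ν(y t^q), H = G_{ν-1}(y t^q) solve the system with κ = y q²/4
(`isSturmPair_bessel`). Thus U(1) = 0 means G_ν(y) = 0, that is y = z², and 1/κ = (2ν/z)². The
weight t^(q-2) may be singular at 0, so ODE uniqueness is replaced by exact integrals:
`IsSturmPair.integral_sq` gives uniqueness from the data at 1 and the norms,
`IsSturmPair.integral_mul` the orthogonality, and `IsSturmPair.wronskian` the fact that no other
solutions occur. Infinitely many zeros come from an oscillation argument
(`not_forall_pos_of_oscillation`); they are isolated because G_ν and G_{ν-1} have no common zero.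

For the law, the spectral theorem is applied in L²(P) to ∫ ⟨φ(s), ·⟩ φ(s) ds, whose nonzero spectrum
is that of the Fredholm operator; this yields the pointwise expansion K(s,t) = ∑ λ_k e_k(s) e_k(t)
(`hasSum_mercer`). The Gaussian series therefore has the covariance of the process, and inside
closed spans of centered Gaussian families the covariance determines the finite-dimensional laws
(`map_eq_map_of_inner_eq`). -/

/-! ### The entire part of the Bessel functions -/

/-- The coefficients of the entire function `besselEntire ν`. -/
noncomputable def besselCoeff (ν : ℝ) (k : ℕ) : ℝ :=
  (-1 / 4) ^ k / (Real.Gamma (ν + k + 1) * Real.Gamma ((k : ℝ) + 1))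

/-- The entire function `G_ν` with `J_ν(x) = (x/2)^ν G_ν(x²)`. -/
noncomputable def besselEntire (ν y : ℝ) : ℝ := ∑' k : ℕ, besselCoeff ν k * y ^ k

theorem besselJ_eq (ν x : ℝ) : besselJ ν x = (x / 2) ^ ν * besselEntire ν (x ^ 2) := by
  unfold besselJ besselEntire besselCoeff
  congr 1
  refine tsum_congr fun k => ?_
  rw [div_mul_eq_mul_div, ← mul_pow]
  congr 2
  ring

theorem besselCoeff_ne_zero {ν : ℝ} (hν : -1 < ν) (k : ℕ) : besselCoeff ν k ≠ 0 := by
  have h1 : 0 < Real.Gamma (ν + k + 1) :=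
    Real.Gamma_pos_of_pos (by have := Nat.cast_nonneg (α := ℝ) k; linarith)
  have h2 : 0 < Real.Gamma ((k : ℝ) + 1) := Real.Gamma_pos_of_pos (by positivity)
  unfold besselCoeff
  positivity

theorem besselCoeff_succ {ν : ℝ} (hν : -1 < ν) (k : ℕ) :
    ((k : ℝ) + 1) * besselCoeff ν (k + 1) = -(1 / 4) * besselCoeff (ν + 1) k := by
  have h2 : 0 < Real.Gamma ((k : ℝ) + 1) := Real.Gamma_pos_of_pos (by positivity)
  have h3 : Real.Gamma ((k : ℝ) + 1 + 1) = ((k : ℝ) + 1) * Real.Gamma ((k : ℝ) + 1) :=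
    Real.Gamma_add_one (by positivity)
  have h1 : 0 < Real.Gamma (ν + 1 + k + 1) :=
    Real.Gamma_pos_of_pos (by have := Nat.cast_nonneg (α := ℝ) k; linarith)
  have h4 : ν + ((k + 1 : ℕ) : ℝ) + 1 = ν + 1 + k + 1 := by push_cast; ring
  unfold besselCoeff
  rw [h4, Nat.cast_succ, h3, pow_succ]
  field_simp

theorem besselCoeff_sub_one {ν : ℝ} (hν : 0 < ν) (k : ℕ) :
    (ν + k) * besselCoeff ν k = besselCoeff (ν - 1) k := by
  have h0 : 0 < ν + k := by positivity
  have h1 : Real.Gamma (ν + k + 1) = (ν + k) * Real.Gamma (ν + k) := Real.Gamma_add_one h0.ne'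
  have h2 : 0 < Real.Gamma (ν + k) := Real.Gamma_pos_of_pos h0
  have h3 : 0 < Real.Gamma ((k : ℝ) + 1) := Real.Gamma_pos_of_pos (by positivity)
  unfold besselCoeff
  rw [h1, show ν - 1 + k + 1 = ν + k by ring]
  field_simp

theorem besselCoeff_ratio {ν : ℝ} (hν : -1 < ν) (k : ℕ) :
    besselCoeff ν (k + 1) = -(1 / 4) / ((ν + k + 1) * (k + 1)) * besselCoeff ν k := by
  have h0 : 0 < ν + k + 1 := by have := Nat.cast_nonneg (α := ℝ) k; linarith
  have h5 := besselCoeff_succ hν k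
  have h6 := besselCoeff_sub_one (show 0 < ν + 1 by linarith) k
  rw [add_sub_cancel_right] at h6
  rw [← h6]
  have : (k : ℝ) + 1 ≠ 0 := by positivity
  field_simp
  linear_combination 4 * (ν + k + 1) * h5

theorem summable_abs_besselCoeff {ν : ℝ} (hν : -1 < ν) (r : ℝ) :
    Summable fun k => |besselCoeff ν k| * |r| ^ k := by
  rcases eq_or_ne r 0 with rfl | hr
  · refine summable_of_ne_finset_zero (s := {0}) fun k hk => ?_
    simp at hk
    simp [hk]
  have hr' : 0 < |r| := abs_pos.2 hr
  have hne : ∀ k, 0 < |besselCoeff ν k| * |r| ^ k := fun k =>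
    mul_pos (abs_pos.2 (besselCoeff_ne_zero hν k)) (pow_pos hr' k)
  refine summable_of_ratio_test_tendsto_lt_one (l := 0) one_pos
    (Eventually.of_forall fun k => (hne k).ne') ?_
  have hlim : Tendsto (fun k : ℕ => (|r| / 4) / (((k : ℝ) + (ν + 1)) * ((k : ℝ) + 1))) atTop
      (𝓝 0) := by
    refine tendsto_const_nhds.div_atTop ?_
    have h := tendsto_natCast_atTop_atTop (R := ℝ)
    exact (tendsto_atTop_add_const_right _ _ h).atTop_mul_atTop₀
      (tendsto_atTop_add_const_right _ _ h)
  refine hlim.congr fun k => ?_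
  have h0 : 0 < ν + k + 1 := by have := Nat.cast_nonneg (α := ℝ) k; linarith
  have hb : |besselCoeff ν k| ≠ 0 := abs_ne_zero.2 (besselCoeff_ne_zero hν k)
  rw [Real.norm_of_nonneg (hne _).le, Real.norm_of_nonneg (hne _).le, besselCoeff_ratio hν,
    abs_mul, abs_div, abs_neg, abs_of_pos (show (0 : ℝ) < 1 / 4 by norm_num),
    abs_of_pos (show 0 < (ν + k + 1) * ((k : ℝ) + 1) by positivity), pow_succ,
    show (k : ℝ) + (ν + 1) = ν + k + 1 by ring]
  field_simp

theorem summable_besselCoeff {ν : ℝ} (hν : -1 < ν) (y : ℝ) :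
    Summable fun k => besselCoeff ν k * y ^ k :=
  Summable.of_norm (by simpa [abs_mul, abs_pow] using summable_abs_besselCoeff hν y)

theorem hasDerivAt_besselEntire {ν : ℝ} (hν : -1 < ν) (y : ℝ) :
    HasDerivAt (besselEntire ν) (-(1 / 4) * besselEntire (ν + 1) y) y := by
  set R := |y| + 1
  have hterm : ∀ (k : ℕ) (x : ℝ), besselCoeff ν (k + 1) * ((k + 1 : ℕ) * x ^ k) =
      -(1 / 4) * (besselCoeff (ν + 1) k * x ^ k) := fun k x => by
    have := besselCoeff_succ hν k
    push_cast
    linear_combination x ^ k * this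
  have hs := (summable_abs_besselCoeff (show -1 < ν + 1 by linarith) R).mul_left (1 / 4)
  have hs' : Summable fun k : ℕ => |besselCoeff ν k| * (k * R ^ (k - 1)) := by
    rw [← summable_nat_add_iff 1]
    refine hs.congr fun k => ?_
    have hR : |R| = R := abs_of_nonneg (by positivity)
    have := congrArg abs (hterm k R)
    rw [abs_mul, abs_mul, abs_mul, abs_mul, abs_pow, hR, abs_neg,
      abs_of_nonneg (show (0 : ℝ) ≤ 1 / 4 by norm_num), Nat.abs_cast] at this
    rw [hR, ← this]
    simp
  have hd := hasDerivAt_tsum_of_isPreconnected (𝕜 := ℝ) (F := ℝ)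
    (g := fun k x => besselCoeff ν k * x ^ k)
    (g' := fun k x => besselCoeff ν k * (k * x ^ (k - 1))) (t := Metric.ball 0 R) (y₀ := 0)
    (y := y) hs' Metric.isOpen_ball (convex_ball _ _).isPreconnected
    (fun k x _ => (hasDerivAt_pow k x).const_mul _)
    (fun k x hx => by
      rw [Real.norm_eq_abs, abs_mul, abs_mul, Nat.abs_cast, abs_pow]
      have : |x| ≤ R := by simpa using (mem_ball_zero_iff.1 hx).le
      gcongr)
    (by simp; positivity) (summable_besselCoeff hν 0) (by simp [R])
  convert! hd using 1
  have hs2 : Summable fun k : ℕ => besselCoeff ν k * (k * y ^ (k - 1)) := by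
    refine Summable.of_norm_bounded hs' fun k => ?_
    rw [Real.norm_eq_abs, abs_mul, abs_mul, Nat.abs_cast, abs_pow]
    have : |y| ≤ R := by simp [R]
    gcongr
  rw [hs2.tsum_eq_zero_add]
  simp only [Nat.cast_zero, zero_mul, mul_zero, zero_add, add_tsub_cancel_right]
  rw [besselEntire, ← tsum_mul_left]
  exact tsum_congr fun k => (hterm k y).symm

/-- This is the classical relation (x^ν J_ν)' = x^ν J_{ν-1}, free of fractional powers.
Coefficientwise it is Γ(ν+k+1) = (ν+k) Γ(ν+k). -/
theorem besselEntire_sub_one {ν : ℝ} (hν : 0 < ν) (y : ℝ) :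
    ν * besselEntire ν y + y * (-(1 / 4) * besselEntire (ν + 1) y) = besselEntire (ν - 1) y := by
  have h1 := summable_besselCoeff (show -1 < ν by linarith) y
  have h2 := summable_besselCoeff (show -1 < ν + 1 by linarith) y
  have h3 := summable_besselCoeff (show -1 < ν - 1 by linarith) y
  unfold besselEntire
  rw [h1.tsum_eq_zero_add, h3.tsum_eq_zero_add, ← tsum_mul_left, ← tsum_mul_left, mul_add,
    ← tsum_mul_left, add_assoc, ← (((summable_nat_add_iff 1).2 h1).mul_left ν).tsum_add
      ((h2.mul_left _).mul_left _)]
  congr 1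
  · have := besselCoeff_sub_one hν 0
    simp only [CharP.cast_eq_zero, add_zero] at this
    simp [← this]
  · refine tsum_congr fun k => ?_
    have e1 := besselCoeff_succ (show -1 < ν by linarith) k
    have e2 := besselCoeff_sub_one hν (k + 1)
    rw [← e2]
    push_cast
    linear_combination (-y ^ (k + 1)) * e1

theorem besselCoeff_zero_pos {ν : ℝ} (hν : -1 < ν) : 0 < besselCoeff ν 0 := by
  have h1 : 0 < Real.Gamma (ν + 1) := Real.Gamma_pos_of_pos (by linarith)
  simp [besselCoeff, h1]

theorem besselEntire_pos_of_nonpos {ν y : ℝ} (hν : -1 < ν) (hy : y ≤ 0) :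
    0 < besselEntire ν y := by
  refine (summable_besselCoeff hν y).tsum_pos (fun k => ?_) 0
    (by simpa using besselCoeff_zero_pos hν)
  have h1 : 0 < Real.Gamma (ν + k + 1) :=
    Real.Gamma_pos_of_pos (by have := Nat.cast_nonneg (α := ℝ) k; linarith)
  have h2 : 0 < Real.Gamma ((k : ℝ) + 1) := Real.Gamma_pos_of_pos (by positivity)
  rw [besselCoeff, div_mul_eq_mul_div, ← mul_pow]
  have : 0 ≤ -1 / 4 * y := by linarith
  positivity

theorem hasDerivAt_besselEntire_sub_one {ν : ℝ} (hν : 0 < ν) (y : ℝ) :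
    HasDerivAt (besselEntire (ν - 1)) (-(1 / 4) * besselEntire ν y) y := by
  simpa using hasDerivAt_besselEntire (show -1 < ν - 1 by linarith) y

theorem continuous_besselEntire {ν : ℝ} (hν : -1 < ν) : Continuous (besselEntire ν) :=
  continuous_iff_continuousAt.2 fun y => (hasDerivAt_besselEntire hν y).continuousAt

/-! ### The Sturm–Liouville system `U' = H`, `H' = -κ t^{q-2} U` -/

/-- `(U, H)` solves `U' = H`, `H' = -κ t^{q-2} U` on `(0,1)`, with `U(0) = 0`. -/
structure IsSturmPair (q κ : ℝ) (U H : ℝ → ℝ) : Prop where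
  continuousOn_fst : ContinuousOn U (Icc 0 1)
  continuousOn_snd : ContinuousOn H (Icc 0 1)
  zero : U 0 = 0
  hasDerivAt_fst : ∀ t ∈ Ioo (0 : ℝ) 1, HasDerivAt U (H t) t
  hasDerivAt_snd : ∀ t ∈ Ioo (0 : ℝ) 1, HasDerivAt H (-κ * t ^ (q - 2) * U t) t

namespace IsSturmPair

variable {q κ κ₁ κ₂ : ℝ} {U H U₁ H₁ U₂ H₂ : ℝ → ℝ}

theorem sub_const_mul (h₁ : IsSturmPair q κ U₁ H₁) (h₂ : IsSturmPair q κ U₂ H₂) (c : ℝ) :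
    IsSturmPair q κ (fun t => U₁ t - c * U₂ t) (fun t => H₁ t - c * H₂ t) where
  continuousOn_fst := h₁.continuousOn_fst.sub (h₂.continuousOn_fst.const_mul c)
  continuousOn_snd := h₁.continuousOn_snd.sub (h₂.continuousOn_snd.const_mul c)
  zero := by simp [h₁.zero, h₂.zero]
  hasDerivAt_fst t ht := (h₁.hasDerivAt_fst t ht).sub ((h₂.hasDerivAt_fst t ht).const_mul c)
  hasDerivAt_snd t ht := by
    convert! (h₁.hasDerivAt_snd t ht).sub ((h₂.hasDerivAt_snd t ht).const_mul c) using 1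
    ring

/-- A Pohozaev-type identity: t H² + κ t^(q-1) U² + (q-1) U H has derivative q H², all terms in U
cancelling. The extra factor t makes the weight continuous at 0, as q > 1. -/
theorem integral_sq (hq : 1 < q) (h : IsSturmPair q κ U H) :
    q * ∫ t in (0 : ℝ)..1, H t ^ 2 = H 1 ^ 2 + κ * U 1 ^ 2 + (q - 1) * (U 1 * H 1) := by
  have hcont : ContinuousOn
      (fun t => t * H t ^ 2 + κ * t ^ (q - 1) * U t ^ 2 + (q - 1) * (U t * H t)) (Icc 0 1) := by
    have hp : ContinuousOn (fun t : ℝ => t ^ (q - 1)) (Icc 0 1) :=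
      (Real.continuous_rpow_const (by linarith)).continuousOn
    have := h.continuousOn_fst
    have := h.continuousOn_snd
    fun_prop
  have hderiv : ∀ t ∈ Ioo (0 : ℝ) 1, HasDerivAt
      (fun t => t * H t ^ 2 + κ * t ^ (q - 1) * U t ^ 2 + (q - 1) * (U t * H t))
      (q * H t ^ 2) t := fun t ht => by
    have hU := h.hasDerivAt_fst t ht
    have hH := h.hasDerivAt_snd t ht
    have hp : HasDerivAt (fun t : ℝ => t ^ (q - 1)) ((q - 1) * t ^ (q - 1 - 1)) t :=
      Real.hasDerivAt_rpow_const (Or.inl ht.1.ne')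
    have hw : t ^ (q - 1) = t ^ (q - 2) * t := by
      rw [← Real.rpow_add_one ht.1.ne']; congr 1; ring
    rw [show q - 1 - 1 = q - 2 by ring] at hp
    convert! (((hasDerivAt_id t).mul (hH.pow 2)).add ((hp.const_mul κ).mul (hU.pow 2))).add
      ((hU.mul hH).const_mul (q - 1)) using 1
    simp only [id, Pi.pow_apply]
    rw [hw]
    push_cast
    ring
  have hint : IntervalIntegrable (fun t => q * H t ^ 2) volume 0 1 := by
    refine ContinuousOn.intervalIntegrable ?_
    rw [uIcc_of_le zero_le_one]
    have := h.continuousOn_snd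
    fun_prop
  rw [← intervalIntegral.integral_const_mul,
    intervalIntegral.integral_eq_sub_of_hasDerivAt_of_le zero_le_one hcont hderiv hint]
  simp [h.zero]

theorem snd_eq_zero (hq : 1 < q) (h : IsSturmPair q κ U H) (hU : U 1 = 0) (hH : H 1 = 0) :
    ∀ t ∈ Icc (0 : ℝ) 1, H t = 0 := by
  have h1 := h.integral_sq hq
  have h2 : ∫ t in (0 : ℝ)..1, H t ^ 2 = 0 := by
    rw [hU, hH] at h1
    have : q ≠ 0 := by linarith
    simpa [this] using h1
  by_contra hne
  push Not at hne
  obtain ⟨t, ht, htne⟩ := hne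
  have hc : ContinuousOn (fun t => H t ^ 2) (Icc 0 1) := h.continuousOn_snd.pow 2
  have := intervalIntegral.integral_pos zero_lt_one hc (fun x _ => sq_nonneg _)
    ⟨t, ht, by positivity⟩
  linarith

/-- Weighting the two halves of the Wronskian by κ₁ and κ₂ makes the terms with t^(q-2) U₁ U₂
cancel. What remains is orthogonality of the H's, not the weighted orthogonality of the U's. -/
theorem integral_mul (h₁ : IsSturmPair q κ₁ U₁ H₁) (h₂ : IsSturmPair q κ₂ U₂ H₂) :
    (κ₁ - κ₂) * ∫ t in (0 : ℝ)..1, H₁ t * H₂ t = κ₁ * (U₁ 1 * H₂ 1) - κ₂ * (U₂ 1 * H₁ 1) := by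
  have hcont : ContinuousOn (fun t => κ₁ * (U₁ t * H₂ t) - κ₂ * (U₂ t * H₁ t)) (Icc 0 1) := by
    have := h₁.continuousOn_fst
    have := h₁.continuousOn_snd
    have := h₂.continuousOn_fst
    have := h₂.continuousOn_snd
    fun_prop
  have hderiv : ∀ t ∈ Ioo (0 : ℝ) 1, HasDerivAt
      (fun t => κ₁ * (U₁ t * H₂ t) - κ₂ * (U₂ t * H₁ t)) ((κ₁ - κ₂) * (H₁ t * H₂ t)) t :=
    fun t ht => by
      convert! (((h₁.hasDerivAt_fst t ht).mul (h₂.hasDerivAt_snd t ht)).const_mul κ₁).sub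
        (((h₂.hasDerivAt_fst t ht).mul (h₁.hasDerivAt_snd t ht)).const_mul κ₂) using 1
      ring
  have hint : IntervalIntegrable (fun t => (κ₁ - κ₂) * (H₁ t * H₂ t)) volume 0 1 := by
    refine ContinuousOn.intervalIntegrable ?_
    rw [uIcc_of_le zero_le_one]
    have := h₁.continuousOn_snd
    have := h₂.continuousOn_snd
    fun_prop
  rw [← intervalIntegral.integral_const_mul,
    intervalIntegral.integral_eq_sub_of_hasDerivAt_of_le zero_le_one hcont hderiv hint]
  simp [h₁.zero, h₂.zero]

theorem wronskian (h₁ : IsSturmPair q κ U₁ H₁) (h₂ : IsSturmPair q κ U₂ H₂) :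
    U₁ 1 * H₂ 1 = U₂ 1 * H₁ 1 := by
  have hcont : ContinuousOn (fun t => U₁ t * H₂ t - U₂ t * H₁ t) (Icc 0 1) := by
    have := h₁.continuousOn_fst
    have := h₁.continuousOn_snd
    have := h₂.continuousOn_fst
    have := h₂.continuousOn_snd
    fun_prop
  have hderiv : ∀ t ∈ Ioo (0 : ℝ) 1, HasDerivAt
      (fun t => U₁ t * H₂ t - U₂ t * H₁ t) 0 t :=
    fun t ht => by
      convert! ((h₁.hasDerivAt_fst t ht).mul (h₂.hasDerivAt_snd t ht)).sub
        ((h₂.hasDerivAt_fst t ht).mul (h₁.hasDerivAt_snd t ht)) using 1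
      ring
  have := intervalIntegral.integral_eq_sub_of_hasDerivAt_of_le zero_le_one hcont hderiv
    intervalIntegrable_const
  simp [h₁.zero, h₂.zero] at this
  linarith

end IsSturmPair

/-- The Bessel solution of the Sturm–Liouville system. -/
theorem isSturmPair_bessel {ν q : ℝ} (hν : 0 < ν) (hq : q = 1 / ν) (y : ℝ) :
    IsSturmPair q (y * q ^ 2 / 4) (fun t => ν * t * besselEntire ν (y * t ^ q))
      (fun t => besselEntire (ν - 1) (y * t ^ q)) := by
  have hq0 : 0 < q := by rw [hq]; positivity
  have hqν : q * ν = 1 := by rw [hq]; field_simp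
  have hp : Continuous fun t : ℝ => t ^ q := Real.continuous_rpow_const hq0.le
  have c1 := continuous_besselEntire (show -1 < ν by linarith)
  have c2 := continuous_besselEntire (show -1 < ν - 1 by linarith)
  have harg : ∀ t : ℝ, 0 < t → HasDerivAt (fun t : ℝ => y * t ^ q) (y * (q * t ^ (q - 1))) t :=
    fun t ht => (Real.hasDerivAt_rpow_const (Or.inl ht.ne')).const_mul y
  refine ⟨by fun_prop, by fun_prop, by simp, fun t ht => ?_, fun t ht => ?_⟩
  · have h1 := (hasDerivAt_besselEntire (show -1 < ν by linarith) (y * t ^ q)).comp t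
      (harg t ht.1)
    convert! ((hasDerivAt_id t).const_mul ν).mul h1 using 1
    rw [← besselEntire_sub_one hν]
    have hw : t ^ q = t ^ (q - 1) * t := by
      rw [← Real.rpow_add_one ht.1.ne']; congr 1; ring
    simp only [id, Function.comp]
    rw [hw]
    linear_combination (-(t ^ (q - 1)) * t * y * (-(1 / 4)) *
      besselEntire (ν + 1) (y * (t ^ (q - 1) * t))) * hqν
  · have h1 := (hasDerivAt_besselEntire_sub_one hν (y * t ^ q)).comp t (harg t ht.1)
    convert! h1 using 1
    have hw : t ^ (q - 1) = t ^ (q - 2) * t := by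
      rw [← Real.rpow_add_one ht.1.ne']; congr 1; ring
    rw [hw]
    linear_combination (-(t ^ (q - 2)) * t * y * q / 4 * besselEntire ν (y * t ^ q)) * hqν

/-- At a common zero the Bessel pair would have U(1) = H(1) = 0, hence H = 0 on [0,1]; but H(0) =
G_{ν-1}(0) > 0. -/
theorem besselEntire_sub_one_ne_zero {ν y : ℝ} (hν : 0 < ν) (hν1 : ν < 1)
    (hy : besselEntire ν y = 0) : besselEntire (ν - 1) y ≠ 0 := by
  intro h
  have hq : 1 < 1 / ν := by rwa [lt_div_iff₀ hν, one_mul]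
  have := (isSturmPair_bessel hν rfl y).snd_eq_zero hq (by simp [hy]) (by simp [h]) 0 (by simp)
  rw [Real.zero_rpow (by linarith), mul_zero] at this
  exact (besselEntire_pos_of_nonpos (show -1 < ν - 1 by linarith) le_rfl).ne' this

/-! ### The zeros of `J_ν` -/

/-- There is no positive solution near infinity of the system satisfied by `(G_ν, G_{ν-1})`. -/
theorem not_forall_pos_of_oscillation {ν : ℝ} (hν : 0 < ν) (hν1 : ν < 1) {f f' g : ℝ → ℝ}
    (hf : ∀ y, HasDerivAt f (f' y) y) (hg : ∀ y, HasDerivAt g (-(1 / 4) * f y) y)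
    (hfg : ∀ y, ν * f y + y * f' y = g y) {a : ℝ} (ha : 0 < a) : ∃ y, a ≤ y ∧ f y ≤ 0 := by
  by_contra! hpos
  have hF : ∀ y, 0 < y → HasDerivAt (fun y => y ^ ν * f y) (y ^ (ν - 1) * g y) y := fun y hy => by
    convert! (Real.hasDerivAt_rpow_const (p := ν) (Or.inl hy.ne')).mul (hf y) using 1
    have hw : y ^ ν = y ^ (ν - 1) * y := by
      rw [← Real.rpow_add_one hy.ne']; congr 1; ring
    rw [hw, ← hfg]
    ring
  have hganti : ∀ x, a ≤ x → ∀ y, x ≤ y → g y ≤ g x := fun x hx y hxy => by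
    refine antitoneOn_of_deriv_nonpos (convex_Ici a)
      (fun z _ => (hg z).continuousAt.continuousWithinAt)
      (fun z _ => (hg z).differentiableAt.differentiableWithinAt) (fun z hz => ?_) hx
      (le_trans hx hxy) hxy
    rw [interior_Ici] at hz
    rw [(hg z).deriv]
    have := hpos z hz.le
    linarith
  have hgstrict : ∀ x, a ≤ x → g (x + 1) < g x := fun x hx => by
    refine strictAntiOn_of_deriv_neg (convex_Ici a)
      (fun z _ => (hg z).continuousAt.continuousWithinAt) (fun z hz => ?_) hx
      (show a ≤ x + 1 by linarith) (by linarith)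
    rw [interior_Ici] at hz
    rw [(hg z).deriv]
    have := hpos z hz.le
    linarith
  have hunbdd : ∀ {c p : ℝ}, 0 < c → 0 < p → ∀ C b : ℝ, ∃ y, b ≤ y ∧ C < c * y ^ p :=
    fun {c p} hc hp C b => by
      have h := (tendsto_rpow_atTop hp).const_mul_atTop hc
      obtain ⟨y, h1, h2⟩ := ((eventually_ge_atTop b).and (h.eventually_gt_atTop C)).exists
      exact ⟨y, h1, h2⟩
  -- Since g decreases strictly, a value g ≤ 0 forces g ≤ -c < 0 from b on. Then (y^ν f)' ≤ -c
  -- y^(ν-1), so y^ν f tends to -∞, against f > 0.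
  have hgpos : ∀ y, a ≤ y → 0 < g y := by
    by_contra! hneg
    obtain ⟨y₁, hy₁, hgy₁⟩ := hneg
    set b := y₁ + 1
    have hb : 0 < b := by linarith
    set c := -g b
    have hc : 0 < c := by have := hgstrict y₁ hy₁; simp only [c, b]; linarith
    have hanti : ∀ y, b ≤ y → y ^ ν * f y + c / ν * y ^ ν ≤ b ^ ν * f b + c / ν * b ^ ν := by
      intro y hy
      have hd : ∀ z, 0 < z → HasDerivAt (fun y => y ^ ν * f y + c / ν * y ^ ν)
          (z ^ (ν - 1) * g z + c / ν * (ν * z ^ (ν - 1))) z := fun z hz =>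
        (hF z hz).add ((Real.hasDerivAt_rpow_const (Or.inl hz.ne')).const_mul _)
      refine antitoneOn_of_deriv_nonpos (convex_Ici b)
        (fun z hz => (hd z (hb.trans_le hz)).continuousAt.continuousWithinAt)
        (fun z hz => ?_) (fun z hz => ?_) self_mem_Ici hy hy
      · rw [interior_Ici] at hz
        exact (hd z (hb.trans hz)).differentiableAt.differentiableWithinAt
      · rw [interior_Ici] at hz
        rw [(hd z (hb.trans hz)).deriv]
        have h1 : g z ≤ g b := hganti b (by linarith) z (le_of_lt hz)
        have h2 : 0 < z ^ (ν - 1) := Real.rpow_pos_of_pos (hb.trans hz) _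
        have h3 : z ^ (ν - 1) * g z + c / ν * (ν * z ^ (ν - 1)) = z ^ (ν - 1) * (g z - g b) := by
          simp only [c]; field_simp; ring
        rw [h3]
        exact mul_nonpos_of_nonneg_of_nonpos h2.le (by linarith)
    obtain ⟨y, hy, hlt⟩ := hunbdd (div_pos hc hν) hν (b ^ ν * f b + c / ν * b ^ ν) b
    have h1 := hanti y hy
    have h2 := hpos y (by linarith)
    have h3 : 0 < y ^ ν := Real.rpow_pos_of_pos (by linarith) _
    nlinarith
  set c := a ^ ν * f a
  have hc : 0 < c := mul_pos (Real.rpow_pos_of_pos ha _) (hpos a le_rfl)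
  have hmono : ∀ y, a ≤ y → c ≤ y ^ ν * f y := by
    intro y hy
    refine monotoneOn_of_deriv_nonneg (f := fun y => y ^ ν * f y) (convex_Ici a)
      (fun z hz => (hF z (ha.trans_le hz)).continuousAt.continuousWithinAt)
      (fun z hz => ?_) (fun z hz => ?_) self_mem_Ici hy hy
    · rw [interior_Ici] at hz
      exact (hF z (ha.trans hz)).differentiableAt.differentiableWithinAt
    · rw [interior_Ici] at hz
      rw [(hF z (ha.trans hz)).deriv]
      exact mul_nonneg (Real.rpow_nonneg (ha.trans hz).le _) (hgpos z (le_of_lt hz)).le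
  -- With g > 0 the function y^ν f increases, so f ≥ c y^(-ν) and g' ≤ -(c/4) y^(-ν). The right side
  -- is the derivative of -d y^(1-ν), and ν < 1 sends g to -∞, contradicting g > 0.
  set d := c / (4 * (1 - ν))
  have hd0 : 0 < d := div_pos hc (by linarith)
  have hanti : ∀ y, a ≤ y → g y + d * y ^ (1 - ν) ≤ g a + d * a ^ (1 - ν) := by
    intro y hy
    have hd : ∀ z, 0 < z → HasDerivAt (fun y => g y + d * y ^ (1 - ν))
        (-(1 / 4) * f z + d * ((1 - ν) * z ^ (1 - ν - 1))) z := fun z hz =>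
      (hg z).add ((Real.hasDerivAt_rpow_const (Or.inl hz.ne')).const_mul _)
    refine antitoneOn_of_deriv_nonpos (convex_Ici a)
      (fun z hz => (hd z (ha.trans_le hz)).continuousAt.continuousWithinAt)
      (fun z hz => ?_) (fun z hz => ?_) self_mem_Ici hy hy
    · rw [interior_Ici] at hz
      exact (hd z (ha.trans hz)).differentiableAt.differentiableWithinAt
    · rw [interior_Ici] at hz
      have hz0 : 0 < z := ha.trans hz
      rw [(hd z hz0).deriv]
      have h1 := hmono z (le_of_lt hz)
      have h2 : 0 < z ^ ν := Real.rpow_pos_of_pos hz0 _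
      have h3 : z ^ (1 - ν - 1) = (z ^ ν)⁻¹ := by
        rw [← Real.rpow_neg hz0.le]; congr 1; ring
      have h4 : d * ((1 - ν) * z ^ (1 - ν - 1)) = 1 / 4 * (c / z ^ ν) := by
        have : 1 - ν ≠ 0 := by linarith
        rw [h3]; simp only [d]; field_simp
      have h5 : c / z ^ ν ≤ f z := by rw [div_le_iff₀ h2]; linarith
      rw [h4]
      linarith
  obtain ⟨y, hy, hlt⟩ := hunbdd hd0 (show 0 < 1 - ν by linarith) (g a + d * a ^ (1 - ν)) a
  have h1 := hanti y hy
  have h2 := hgpos y hy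
  linarith

/-- The oscillation argument applies to G_ν and to -G_ν, so both signs (or zero) occur beyond a, and
the intermediate value theorem concludes. -/
theorem exists_besselEntire_eq_zero {ν : ℝ} (hν : 0 < ν) (hν1 : ν < 1) {a : ℝ} (ha : 0 < a) :
    ∃ y, a ≤ y ∧ besselEntire ν y = 0 := by
  have hν' : -1 < ν := by linarith
  obtain ⟨y₁, h1, h1'⟩ := not_forall_pos_of_oscillation hν hν1
    (fun y => hasDerivAt_besselEntire hν' y) (fun y => hasDerivAt_besselEntire_sub_one hν y)
    (fun y => besselEntire_sub_one hν y) ha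
  obtain ⟨y₂, h2, h2'⟩ := not_forall_pos_of_oscillation hν hν1
    (f := fun y => -besselEntire ν y) (g := fun y => -besselEntire (ν - 1) y)
    (fun y => (hasDerivAt_besselEntire hν' y).neg)
    (fun y => by convert! (hasDerivAt_besselEntire_sub_one hν y).neg using 1; ring)
    (fun y => by rw [← besselEntire_sub_one hν y]; ring) ha
  have h2'' : 0 ≤ besselEntire ν y₂ := by simpa using h2'
  obtain ⟨y, hy, hy'⟩ := (isPreconnected_Ici (a := a)).intermediate_value h1 h2
    (continuous_besselEntire hν').continuousOn ⟨h1', h2''⟩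
  exact ⟨y, hy, hy'⟩

theorem besselJ_eq_zero_iff {ν x : ℝ} (hx : 0 < x) :
    besselJ ν x = 0 ↔ besselEntire ν (x ^ 2) = 0 := by
  rw [besselJ_eq, mul_eq_zero, or_iff_right (Real.rpow_pos_of_pos (by positivity) _).ne']

/-- The positive zeros of `J_ν` are isolated. -/
theorem eventually_besselEntire_sq_ne_zero {ν x : ℝ} (hν : 0 < ν) (hν1 : ν < 1) (hx : 0 ≤ x) :
    ∀ᶠ z in 𝓝[≠] x, besselEntire ν (z ^ 2) ≠ 0 := by
  have hν' : -1 < ν := by linarith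
  by_cases h0 : besselEntire ν (x ^ 2) = 0
  · have hd : HasDerivAt (fun z => besselEntire ν (z ^ 2))
        (-(1 / 4) * besselEntire (ν + 1) (x ^ 2) * (2 * x)) x := by
      convert! (hasDerivAt_besselEntire hν' (x ^ 2)).comp x (hasDerivAt_pow 2 x) using 1
      simp
    -- A multiple zero would have G_ν = G_{ν+1} = 0, hence also G_{ν-1} = 0 by the recurrence, which
    -- is excluded.
    refine hd.eventually_ne fun h => ?_
    have hx0 : x ≠ 0 := by
      rintro rfl
      exact (besselEntire_pos_of_nonpos hν' (y := 0 ^ 2) (by simp)).ne' h0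
    have h1 := besselEntire_sub_one hν (x ^ 2)
    have h2 : besselEntire (ν + 1) (x ^ 2) = 0 := by simpa [hx0] using h
    rw [h0, h2] at h1
    exact besselEntire_sub_one_ne_zero hν hν1 h0 (by rw [← h1]; ring)
  · have hc : Continuous fun z : ℝ => besselEntire ν (z ^ 2) :=
      (continuous_besselEntire hν').comp (continuous_pow 2)
    exact (hc.continuousAt.eventually_ne h0).filter_mono nhdsWithin_le_nhds

/-- For `a ≥ 0` there is a smallest zero of `J_ν` beyond `a`. -/
theorem isLeast_besselJ_zeros {ν a : ℝ} (hν : 0 < ν) (hν1 : ν < 1) (ha : 0 ≤ a) :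
    IsLeast {x | a < x ∧ besselJ ν x = 0} (sInf {x | a < x ∧ besselJ ν x = 0}) := by
  set Z := {x | a < x ∧ besselJ ν x = 0}
  have hc : Continuous fun z : ℝ => besselEntire ν (z ^ 2) :=
    (continuous_besselEntire (by linarith)).comp (continuous_pow 2)
  have hne : Z.Nonempty := by
    obtain ⟨y, hy, hy0⟩ := exists_besselEntire_eq_zero hν hν1 (show 0 < (a + 1) ^ 2 by positivity)
    have hy' : a + 1 ≤ √y := Real.le_sqrt_of_sq_le hy
    have hpos : 0 < √y := by linarith
    refine ⟨√y, by linarith, ?_⟩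
    rw [besselJ_eq_zero_iff hpos, Real.sq_sqrt (by nlinarith), hy0]
  have hbdd : BddBelow Z := ⟨a, fun x hx => hx.1.le⟩
  have hle : a ≤ sInf Z := le_csInf hne fun x hx => hx.1.le
  refine ⟨?_, fun x hx => csInf_le hbdd hx⟩
  -- An infimum that is not attained, including the case where it equals a, would be an accumulation
  -- point of zeros.
  by_contra hnot
  have hcl : sInf Z ∈ closure Z := csInf_mem_closure hne hbdd
  have hfreq : ∃ᶠ z in 𝓝[≠] (sInf Z), z ∈ Z := by
    rw [mem_closure_iff_frequently] at hcl
    rw [frequently_nhdsWithin_iff]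
    exact hcl.mono fun z hz => ⟨hz, fun h => hnot (by rw [mem_singleton_iff] at h; rwa [← h])⟩
  obtain ⟨z, hz, hz'⟩ :=
    (hfreq.and_eventually (eventually_besselEntire_sq_ne_zero hν hν1 (ha.trans hle))).exists
  exact hz' ((besselJ_eq_zero_iff (ha.trans_lt hz.1)).1 hz.2)

theorem besselZero_pos {ν : ℝ} (hν : 0 < ν) (hν1 : ν < 1) (k : ℕ) : 0 < besselZero ν k := by
  induction k with
  | zero => exact (isLeast_besselJ_zeros hν hν1 le_rfl).1.1
  | succ k ih => exact ih.trans (isLeast_besselJ_zeros hν hν1 ih.le).1.1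

theorem besselJ_besselZero {ν : ℝ} (hν : 0 < ν) (hν1 : ν < 1) (k : ℕ) :
    besselJ ν (besselZero ν k) = 0 := by
  cases k with
  | zero => exact (isLeast_besselJ_zeros hν hν1 le_rfl).1.2
  | succ k => exact (isLeast_besselJ_zeros hν hν1 (besselZero_pos hν hν1 k).le).1.2

theorem besselZero_strictMono {ν : ℝ} (hν : 0 < ν) (hν1 : ν < 1) : StrictMono (besselZero ν) :=
  strictMono_nat_of_lt_succ fun k =>
    (isLeast_besselJ_zeros hν hν1 (besselZero_pos hν hν1 k).le).1.1

/-- By minimality of each successive zero, a missed zero would exceed all the enumerated ones; these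
would then converge to an accumulation point of zeros, which isolation forbids. -/
theorem range_besselZero {ν : ℝ} (hν : 0 < ν) (hν1 : ν < 1) :
    range (besselZero ν) = {x : ℝ | 0 < x ∧ besselJ ν x = 0} := by
  refine Subset.antisymm (range_subset_iff.2 fun k =>
    ⟨besselZero_pos hν hν1 k, besselJ_besselZero hν hν1 k⟩) fun x hx => ?_
  by_contra hnot
  have hlt : ∀ k, besselZero ν k < x := by
    intro k
    induction k with
    | zero =>
      exact lt_of_le_of_ne ((isLeast_besselJ_zeros hν hν1 le_rfl).2 hx) fun h => hnot ⟨0, h⟩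
    | succ k ih =>
      exact lt_of_le_of_ne ((isLeast_besselJ_zeros hν hν1 (besselZero_pos hν hν1 k).le).2
        ⟨ih, hx.2⟩) fun h => hnot ⟨k + 1, h⟩
  have hmono := besselZero_strictMono hν hν1
  have hbdd : BddAbove (range (besselZero ν)) := ⟨x, by rintro _ ⟨k, rfl⟩; exact (hlt k).le⟩
  have hlim := tendsto_atTop_ciSup hmono.monotone hbdd
  set L := ⨆ k, besselZero ν k
  have hL : ∀ k, besselZero ν k < L := fun k =>
    (hmono (Nat.lt_succ_self k)).trans_le (le_ciSup hbdd (k + 1))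
  have hlim' : Tendsto (besselZero ν) atTop (𝓝[≠] L) :=
    tendsto_nhdsWithin_iff.2 ⟨hlim, Eventually.of_forall fun k => (hL k).ne⟩
  have hL0 : 0 ≤ L := (besselZero_pos hν hν1 0).le.trans (hL 0).le
  obtain ⟨k, hk⟩ := (hlim'.eventually (eventually_besselEntire_sq_ne_zero hν hν1 hL0)).exists
  exact hk ((besselJ_eq_zero_iff (besselZero_pos hν hν1 k)).1 (besselJ_besselZero hν hν1 k))

theorem besselEntire_besselZero {ν : ℝ} (hν : 0 < ν) (hν1 : ν < 1) (k : ℕ) :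
    besselEntire ν (besselZero ν k ^ 2) = 0 :=
  (besselJ_eq_zero_iff (besselZero_pos hν hν1 k)).1 (besselJ_besselZero hν hν1 k)

theorem exists_besselZero_sq_eq {ν y : ℝ} (hν : 0 < ν) (hν1 : ν < 1)
    (hy : besselEntire ν y = 0) : ∃ k, besselZero ν k ^ 2 = y := by
  have hy0 : 0 < y := by
    by_contra! h
    exact (besselEntire_pos_of_nonpos (by linarith) h).ne' hy
  have : √y ∈ range (besselZero ν) := by
    rw [range_besselZero hν hν1]
    refine ⟨Real.sqrt_pos.2 hy0, ?_⟩
    rw [besselJ_eq_zero_iff (Real.sqrt_pos.2 hy0), Real.sq_sqrt hy0.le, hy]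
  obtain ⟨k, hk⟩ := this
  exact ⟨k, by rw [hk, Real.sq_sqrt hy0.le]⟩

/-! ### Gram kernels and Mercer's theorem -/

section Mercer

variable {E : Type*} [NormedAddCommGroup E] [InnerProductSpace ℝ E]

/-- The kernel `K(s,t) = ⟪φ s, φ t⟫`. -/
noncomputable def gramKernel (φ : ℝ → E) (s t : ℝ) : ℝ := inner ℝ (φ s) (φ t)

instance isProbabilityMeasure_volume_Icc_zero_one :
    IsProbabilityMeasure ((volume : Measure ℝ).restrict (Icc 0 1)) :=
  ⟨by simp⟩

theorem integrableOn_smul_of_continuous {φ : ℝ → E} (hφ : Continuous φ) {h : ℝ → ℝ}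
    (hh : IntegrableOn h (Icc 0 1)) : IntegrableOn (fun s => h s • φ s) (Icc 0 1) := by
  obtain ⟨C, hC⟩ := isCompact_Icc.exists_bound_of_continuousOn (hφ.continuousOn (s := Icc 0 1))
  exact Integrable.smul_bdd hh C hφ.aestronglyMeasurable
    ((ae_restrict_iff' measurableSet_Icc).2 (Eventually.of_forall hC))

theorem integral_Icc_eq_intervalIntegral {F : Type*} [NormedAddCommGroup F] [NormedSpace ℝ F]
    (f : ℝ → F) : ∫ t in Icc (0 : ℝ) 1, f t = ∫ t in (0 : ℝ)..1, f t := by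
  rw [integral_Icc_eq_integral_Ioc, intervalIntegral.integral_of_le zero_le_one]

theorem continuous_rankOne_self {φ : ℝ → E} (hφ : Continuous φ) :
    Continuous fun s => InnerProductSpace.rankOne ℝ (φ s) (φ s) := by
  have h1 : Continuous fun s => InnerProductSpace.rankOne ℝ (F := E) (φ s) :=
    (InnerProductSpace.rankOne ℝ (E := E) (F := E)).continuous.comp hφ
  exact h1.clm_apply hφ

/-- The operator `∫ ⟪φ s, ·⟫ φ s ds`. -/
noncomputable def frameOperator (φ : ℝ → E) : E →L[ℝ] E :=
  ∫ s in Icc (0 : ℝ) 1, InnerProductSpace.rankOne ℝ (φ s) (φ s)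

theorem frameOperator_apply {φ : ℝ → E} (hφ : Continuous φ) (x : E) :
    frameOperator φ x = ∫ s in Icc (0 : ℝ) 1, inner ℝ (φ s) x • φ s := by
  unfold frameOperator
  rw [ContinuousLinearMap.integral_apply (continuous_rankOne_self hφ).continuousOn.integrableOn_Icc]
  simp

variable [CompleteSpace E] {φ : ℝ → E}

theorem fredholm_gramKernel (hφ : Continuous φ) {h : ℝ → ℝ} (hh : IntegrableOn h (Icc 0 1))
    (t : ℝ) : fredholm (gramKernel φ) h t = inner ℝ (φ t) (∫ s in Icc (0 : ℝ) 1, h s • φ s) := by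
  rw [← integral_inner (integrableOn_smul_of_continuous hφ hh)]
  unfold fredholm gramKernel
  refine integral_congr_ae (Eventually.of_forall fun s => ?_)
  simp only [inner_smul_right]
  rw [real_inner_comm, mul_comm]

theorem continuous_fredholm_gramKernel (hφ : Continuous φ) {h : ℝ → ℝ}
    (hh : IntegrableOn h (Icc 0 1)) : Continuous (fredholm (gramKernel φ) h) := by
  rw [funext (fredholm_gramKernel hφ hh)]
  fun_prop

theorem integral_fredholm_gramKernel (hφ : Continuous φ) (h0 : ∫ s in Icc (0 : ℝ) 1, φ s = 0)
    {h : ℝ → ℝ} (hh : IntegrableOn h (Icc 0 1)) :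
    ∫ t in Icc (0 : ℝ) 1, fredholm (gramKernel φ) h t = 0 := by
  rw [funext (fredholm_gramKernel hφ hh)]
  simp_rw [real_inner_comm (∫ s in Icc (0 : ℝ) 1, h s • φ s)]
  rw [integral_inner hφ.continuousOn.integrableOn_Icc, h0, inner_zero_right]

theorem inner_frameOperator (hφ : Continuous φ) (x y : E) :
    inner ℝ y (frameOperator φ x) = ∫ s in Icc (0 : ℝ) 1, inner ℝ (φ s) x * inner ℝ (φ s) y := by
  rw [frameOperator_apply hφ, ← integral_inner (Continuous.integrableOn_Icc (by fun_prop))]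
  simp_rw [inner_smul_right, real_inner_comm y]

theorem isSymmetric_frameOperator (hφ : Continuous φ) :
    (frameOperator φ).IsSymmetric := fun x y => by
  change inner ℝ (frameOperator φ x) y = inner ℝ x (frameOperator φ y)
  rw [real_inner_comm, inner_frameOperator hφ, inner_frameOperator hφ]
  simp_rw [mul_comm]

/-- An integral of rank-one operators lies in the closed subspace of compact operators. -/
theorem isCompactOperator_frameOperator (hφ : Continuous φ) :
    IsCompactOperator (frameOperator φ) := by
  refine Convex.integral_mem (s := {T : E →L[ℝ] E | IsCompactOperator T})
    (compactOperator (RingHom.id ℝ) E E).convex isClosed_setOfPred_isCompactOperator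
    (Eventually.of_forall fun s => ?_) (continuous_rankOne_self hφ).continuousOn.integrableOn_Icc
  change IsCompactOperator (InnerProductSpace.rankOne ℝ (φ s) (φ s))
  rw [InnerProductSpace.rankOne_def']
  have h : IsCompactOperator (ContinuousLinearMap.toSpanSingleton ℝ (φ s)) :=
    isCompactOperator_of_locallyCompactSpace_rng _
  exact h.comp_clm (innerSL ℝ (φ s))

/-- **Mercer's theorem** for a Gram kernel: the expansion along any orthonormal system of
eigenfunctions that exhausts the continuous eigenfunctions of nonzero eigenvalues. -/
theorem hasSum_mercer (hφ : Continuous φ) {lam : ℕ → ℝ} {e : ℕ → ℝ → ℝ} (hlam : ∀ k, 0 < lam k)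
    (he : ∀ k, Continuous (e k))
    (horth : ∀ k l, ∫ t in Icc (0 : ℝ) 1, e k t * e l t = if k = l then 1 else 0)
    (heig : ∀ k, ∀ t ∈ Icc (0 : ℝ) 1, fredholm (gramKernel φ) (e k) t = lam k * e k t)
    (hex : ∀ (μ : ℝ) (h : ℝ → ℝ), μ ≠ 0 → Continuous h →
      (∀ t, fredholm (gramKernel φ) h t = μ * h t) → (∃ t ∈ Icc (0 : ℝ) 1, h t ≠ 0) →
      ∃ k c, ∀ t ∈ Icc (0 : ℝ) 1, h t = c * e k t)
    {s t : ℝ} (hs : s ∈ Icc (0 : ℝ) 1) (ht : t ∈ Icc (0 : ℝ) 1) :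
    HasSum (fun k => lam k * e k s * e k t) (gramKernel φ s t) := by
  have hsq : ∀ k, 0 < √(lam k) := fun k => Real.sqrt_pos.2 (hlam k)
  have hmul : ∀ k, √(lam k) * √(lam k) = lam k := fun k => Real.mul_self_sqrt (hlam k).le
  have hei : ∀ k, IntegrableOn (e k) (Icc 0 1) := fun k => (he k).integrableOn_Icc
  -- These are the normalized images in E of the eigenfunctions: with T h = ∫ h φ, the Fredholm
  -- operator is T*T and the frame operator is TT*.
  set f : ℕ → E := fun k => (√(lam k))⁻¹ • ∫ s in Icc (0 : ℝ) 1, e k s • φ s with hf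
  have hfφ : ∀ k, ∀ t ∈ Icc (0 : ℝ) 1, inner ℝ (f k) (φ t) = √(lam k) * e k t := by
    intro k t ht
    rw [real_inner_comm, hf, inner_smul_right, ← fredholm_gramKernel hφ (hei k), heig k t ht]
    have := (hsq k).ne'
    have := hmul k
    field_simp
    rw [sq, this]
  have hinner : ∀ x k, inner ℝ x (f k) =
      (√(lam k))⁻¹ * ∫ t in Icc (0 : ℝ) 1, e k t * inner ℝ x (φ t) := by
    intro x k
    rw [hf, inner_smul_right, ← integral_inner (integrableOn_smul_of_continuous hφ (hei k))]
    simp_rw [inner_smul_right]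
  have hON : Orthonormal ℝ f := by
    rw [orthonormal_iff_ite]
    intro k l
    rw [hinner]
    have : ∫ t in Icc (0 : ℝ) 1, e l t * inner ℝ (f k) (φ t) =
        √(lam k) * ∫ t in Icc (0 : ℝ) 1, e k t * e l t := by
      rw [← integral_const_mul]
      refine setIntegral_congr_fun measurableSet_Icc fun t ht => ?_
      simp only [hfφ k t ht]
      ring
    rw [this, horth]
    split_ifs with h
    · subst h
      have := (hsq k).ne'
      field_simp
    · simp
  -- By Bessel's inequality y exists; it is the projection of φ(t) to the closed span of the f_k.
  -- The goal is that φ(t) = y.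
  obtain ⟨y, hy⟩ : Summable fun k => inner ℝ (f k) (φ t) • f k := by
    have h1 := hON.inner_products_summable (φ t)
    refine (hON.orthogonalFamily.summable_iff_norm_sq_summable
      fun k => inner ℝ (f k) (φ t)).2 ?_
    exact h1
  have hyz : ∀ z, HasSum (fun k => inner ℝ (f k) (φ t) * inner ℝ z (f k)) (inner ℝ z y) :=
    fun z => by simpa [inner_smul_right] using (innerSL ℝ z).hasSum hy
  have hfg : ∀ k, inner ℝ (f k) (φ t - y) = 0 := by
    intro k
    rw [inner_sub_right, sub_eq_zero]
    refine HasSum.unique ?_ (hyz (f k))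
    convert! hasSum_ite_eq k (inner ℝ (f k) (φ t)) using 2 with l
    rw [orthonormal_iff_ite.1 hON]
    by_cases h : k = l <;> simp [h, eq_comm]
  have hzero : φ t - y = 0 := by
    have hbot := ContinuousLinearMap.orthogonalComplement_iSup_eigenspaces_eq_bot
      (isCompactOperator_frameOperator hφ) (isSymmetric_frameOperator hφ)
    rw [← Submodule.mem_bot ℝ, ← hbot, ← Submodule.iInf_orthogonal, Submodule.mem_iInf]
    intro μ z hz
    rw [Module.End.mem_eigenspace_iff] at hz
    replace hz : frameOperator φ z = μ • z := hz
    -- If ⟨φ(·), z⟩ is not zero on [0,1], it is a continuous eigenfunction, so z is a multiple of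
    -- some f_k. Otherwise z is orthogonal to the curve on [0,1], hence to every f_k and to y.
    by_cases hvan : ∃ t ∈ Icc (0 : ℝ) 1, inner ℝ (φ t) z ≠ 0
    · have hne : μ ≠ 0 := by
        rintro rfl
        obtain ⟨t₀, ht₀, hne⟩ := hvan
        have h1 := inner_frameOperator hφ z z
        rw [hz, zero_smul, inner_zero_right, integral_Icc_eq_intervalIntegral] at h1
        have hc : Continuous fun s => inner ℝ (φ s) z * inner ℝ (φ s) z := by fun_prop
        have := intervalIntegral.integral_pos zero_lt_one hc.continuousOn
          (fun x _ => mul_self_nonneg _) ⟨t₀, ht₀, mul_self_pos.2 hne⟩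
        linarith
      have hc : Continuous fun t => inner ℝ (φ t) z := by fun_prop
      obtain ⟨k, c, hkc⟩ := hex μ (fun t => inner ℝ (φ t) z) hne hc
        (fun t => by
          rw [fredholm_gramKernel hφ hc.integrableOn_Icc, ← frameOperator_apply hφ, hz,
            inner_smul_right]) hvan
      have hzf : μ • z = (c * √(lam k)) • f k := by
        rw [← hz, frameOperator_apply hφ, hf, smul_smul, mul_assoc,
          mul_inv_cancel₀ (hsq k).ne', mul_one, ← integral_smul]
        refine setIntegral_congr_fun measurableSet_Icc fun s hs => ?_
        simp only [hkc s hs, mul_smul]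
      have h2 : μ * inner ℝ z (φ t - y) = 0 := by
        rw [← real_inner_smul_left, hzf, real_inner_smul_left, hfg, mul_zero]
      exact (mul_eq_zero.1 h2).resolve_left hne
    · push Not at hvan
      have hzφ : ∀ t ∈ Icc (0 : ℝ) 1, inner ℝ z (φ t) = 0 := fun t ht => by
        rw [real_inner_comm, hvan t ht]
      have hzf : ∀ k, inner ℝ z (f k) = 0 := fun k => by
        rw [hinner, setIntegral_eq_zero_of_forall_eq_zero fun t ht => by rw [hzφ t ht, mul_zero],
          mul_zero]
      have h3 := hyz z
      simp only [hzf, mul_zero] at h3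
      rw [inner_sub_right, hzφ t ht, h3.unique hasSum_zero, sub_zero]
  have := hyz (φ s)
  rw [← sub_eq_zero.1 hzero] at this
  convert! this using 2 with k
  rw [real_inner_comm, real_inner_comm, hfφ k t ht, real_inner_comm, hfφ k s hs]
  linear_combination (-(e k s * e k t)) * hmul k

end Mercer

/-! ### The eigenvalue problem of the kernel `min(s,t)^β / β + a(s) + a(t)` -/

section Kernel

variable {E : Type*} [NormedAddCommGroup E] [InnerProductSpace ℝ E]
  {φ : ℝ → E} {β : ℝ} {a : ℝ → ℝ}

/-- A continuous curve of integral zero in a Hilbert space, with Gram kernel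
`min(s,t)^β / β + a(s) + a(t)`. -/
structure IsCenteredCurve (β : ℝ) (a : ℝ → ℝ) (φ : ℝ → E) : Prop where
  pos : 0 < β
  continuous : Continuous φ
  continuous_aux : Continuous a
  integral_eq_zero : ∫ s in Icc (0 : ℝ) 1, φ s = 0
  inner_eq : ∀ s ∈ Icc (0 : ℝ) 1, ∀ t ∈ Icc (0 : ℝ) 1,
    inner ℝ (φ s) (φ t) = min s t ^ β / β + a s + a t

namespace IsCenteredCurve

/-- Mean zero removes a(t) ∫ h and turns ∫_t^1 h into -∫_0^t h; the remaining contribution of a does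
not depend on t. -/
theorem fredholm_eq (hφ : IsCenteredCurve β a φ) {h : ℝ → ℝ} (hh : Continuous h)
    (h0 : ∫ s in (0 : ℝ)..1, h s = 0) {t : ℝ} (ht : t ∈ Icc (0 : ℝ) 1) :
    fredholm (gramKernel φ) h t =
      1 / β * ((∫ s in (0 : ℝ)..t, s ^ β * h s) - t ^ β * ∫ s in (0 : ℝ)..t, h s) +
        ∫ s in (0 : ℝ)..1, a s * h s := by
  have hp : Continuous fun s : ℝ => s ^ β := Real.continuous_rpow_const hφ.pos.le
  have ha := hφ.continuous_aux
  have hi : ∀ x y, IntervalIntegrable h volume x y := fun x y => hh.intervalIntegrable x y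
  have hm : Continuous fun s : ℝ => min s t ^ β * h s :=
    (hp.comp (continuous_id.min continuous_const)).mul hh
  have h1 : fredholm (gramKernel φ) h t =
      ∫ s in (0 : ℝ)..1, (1 / β * (min s t ^ β * h s) + a s * h s + a t * h s) := by
    rw [← integral_Icc_eq_intervalIntegral]
    refine setIntegral_congr_fun measurableSet_Icc fun s hs => ?_
    simp only [gramKernel, hφ.inner_eq s hs t ht]
    ring
  have h2 : ∫ s in (0 : ℝ)..1, min s t ^ β * h s =
      (∫ s in (0 : ℝ)..t, s ^ β * h s) + t ^ β * ∫ s in t..1, h s := by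
    rw [← intervalIntegral.integral_add_adjacent_intervals (hm.intervalIntegrable 0 t)
      (hm.intervalIntegrable t 1), ← intervalIntegral.integral_const_mul]
    congr 1
    · refine intervalIntegral.integral_congr fun s hs => ?_
      rw [uIcc_of_le ht.1] at hs
      simp only [min_eq_left hs.2]
    · refine intervalIntegral.integral_congr fun s hs => ?_
      rw [uIcc_of_le ht.2] at hs
      simp only [min_eq_right hs.1]
  have h3 : ∫ s in t..1, h s = -∫ s in (0 : ℝ)..t, h s := by
    have := intervalIntegral.integral_add_adjacent_intervals (hi 0 t) (hi t 1)
    linarith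
  rw [h1, intervalIntegral.integral_add, intervalIntegral.integral_add,
    intervalIntegral.integral_const_mul, intervalIntegral.integral_const_mul, h0, h2, h3]
  · ring
  all_goals exact Continuous.intervalIntegrable (by fun_prop) _ _

theorem hasDerivAt_fredholm (hφ : IsCenteredCurve β a φ) {h : ℝ → ℝ} (hh : Continuous h)
    (h0 : ∫ s in (0 : ℝ)..1, h s = 0) {t : ℝ} (ht : t ∈ Ioo (0 : ℝ) 1) :
    HasDerivAt (fredholm (gramKernel φ) h) (-t ^ (β - 1) * ∫ s in (0 : ℝ)..t, h s) t := by
  have hp : Continuous fun s : ℝ => s ^ β := Real.continuous_rpow_const hφ.pos.le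
  have hev : fredholm (gramKernel φ) h =ᶠ[𝓝 t] fun t =>
      1 / β * ((∫ s in (0 : ℝ)..t, s ^ β * h s) - t ^ β * ∫ s in (0 : ℝ)..t, h s) +
        ∫ s in (0 : ℝ)..1, a s * h s := by
    filter_upwards [isOpen_Ioo.mem_nhds ht] with x hx
    exact hφ.fredholm_eq hh h0 (Ioo_subset_Icc_self hx)
  refine HasDerivAt.congr_of_eventuallyEq ?_ hev
  have d1 : HasDerivAt (fun t => ∫ s in (0 : ℝ)..t, s ^ β * h s) (t ^ β * h t) t :=
    (hp.mul hh).integral_hasStrictDerivAt 0 t |>.hasDerivAt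
  have d2 : HasDerivAt (fun t => ∫ s in (0 : ℝ)..t, h s) (h t) t :=
    hh.integral_hasStrictDerivAt 0 t |>.hasDerivAt
  have d3 : HasDerivAt (fun t : ℝ => t ^ β) (β * t ^ (β - 1)) t :=
    Real.hasDerivAt_rpow_const (Or.inl ht.1.ne')
  convert! ((d1.sub (d3.mul d2)).const_mul (1 / β)).add_const _ using 1
  have := hφ.pos.ne'
  field_simp
  ring

/-- The second component of a Dirichlet solution of the Sturm–Liouville system is an
eigenfunction. -/
theorem fredholm_eq_of_isSturmPair [CompleteSpace E] (hφ : IsCenteredCurve β a φ) {κ : ℝ} (hκ : κ ≠ 0)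
    {U H : ℝ → ℝ} (hUH : IsSturmPair (β + 1) κ U H) (hH : Continuous H) (hU : U 1 = 0) :
    ∀ t ∈ Icc (0 : ℝ) 1, fredholm (gramKernel φ) H t = κ⁻¹ * H t := by
  have hint : ∀ t ∈ Icc (0 : ℝ) 1, ∫ s in (0 : ℝ)..t, H s = U t := fun t ht => by
    rw [intervalIntegral.integral_eq_sub_of_hasDerivAt_of_le ht.1
      (hUH.continuousOn_fst.mono (Icc_subset_Icc_right ht.2))
      (fun x hx => hUH.hasDerivAt_fst x ⟨hx.1, hx.2.trans_le ht.2⟩) (hH.intervalIntegrable _ _),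
      hUH.zero, sub_zero]
  have h0 : ∫ s in (0 : ℝ)..1, H s = 0 := by rw [hint 1 (by simp), hU]
  have hHi : IntegrableOn H (Icc 0 1) := hH.integrableOn_Icc
  have hTc := continuous_fredholm_gramKernel hφ.continuous hHi
  have hderiv : ∀ t ∈ Ioo (0 : ℝ) 1,
      HasDerivAt (fun t => fredholm (gramKernel φ) H t - κ⁻¹ * H t) 0 t := fun t ht => by
    convert! (hφ.hasDerivAt_fredholm hH h0 ht).sub
      ((hUH.hasDerivAt_snd t ht).const_mul κ⁻¹) using 1
    rw [hint t (Ioo_subset_Icc_self ht), show β + 1 - 2 = β - 1 by ring]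
    field_simp
    ring
  have hconst : ∀ t ∈ Icc (0 : ℝ) 1, fredholm (gramKernel φ) H t - κ⁻¹ * H t =
      fredholm (gramKernel φ) H 0 - κ⁻¹ * H 0 := fun t ht => by
    have := intervalIntegral.integral_eq_sub_of_hasDerivAt_of_le ht.1
      (f := fun t => fredholm (gramKernel φ) H t - κ⁻¹ * H t) (f' := fun _ => 0)
      (by fun_prop) (fun x hx => hderiv x ⟨hx.1, hx.2.trans_le ht.2⟩) intervalIntegrable_const
    rw [intervalIntegral.integral_zero] at this
    linarith
  -- The constant is fixed by its mean: the operator has mean-zero range, and ∫ H = U(1) = 0.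
  have hmean : ∫ t in Icc (0 : ℝ) 1, (fredholm (gramKernel φ) H t - κ⁻¹ * H t) = 0 := by
    rw [integral_sub hTc.integrableOn_Icc (hHi.const_mul _),
      integral_fredholm_gramKernel hφ.continuous hφ.integral_eq_zero hHi, integral_const_mul,
      integral_Icc_eq_intervalIntegral, h0]
    simp
  rw [setIntegral_congr_fun measurableSet_Icc hconst] at hmean
  simp at hmean
  intro t ht
  have := hconst t ht
  linarith

/-- A continuous eigenfunction yields a Dirichlet solution of the Sturm–Liouville system. -/
theorem isSturmPair_of_fredholm_eq [CompleteSpace E] (hφ : IsCenteredCurve β a φ) {μ : ℝ} (hμ : μ ≠ 0)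
    {h : ℝ → ℝ} (hh : Continuous h) (heig : ∀ t, fredholm (gramKernel φ) h t = μ * h t) :
    IsSturmPair (β + 1) μ⁻¹ (fun t => ∫ s in (0 : ℝ)..t, h s) h ∧ ∫ s in (0 : ℝ)..1, h s = 0 := by
  have h0 : ∫ s in (0 : ℝ)..1, h s = 0 := by
    have := integral_fredholm_gramKernel hφ.continuous hφ.integral_eq_zero
      (hh.integrableOn_Icc (a := 0) (b := 1))
    rw [funext heig, integral_const_mul, integral_Icc_eq_intervalIntegral] at this
    exact (mul_eq_zero.1 this).resolve_left hμ
  have hd : ∀ t, HasDerivAt (fun t => ∫ s in (0 : ℝ)..t, h s) (h t) t := fun t =>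
    (hh.integral_hasStrictDerivAt 0 t).hasDerivAt
  refine ⟨⟨fun t _ => (hd t).continuousAt.continuousWithinAt, hh.continuousOn, by simp,
    fun t _ => hd t, fun t ht => ?_⟩, h0⟩
  have h1 := (hφ.hasDerivAt_fredholm hh h0 ht).const_mul μ⁻¹
  have h2 : (fun t => μ⁻¹ * fredholm (gramKernel φ) h t) = h := by
    funext t
    rw [heig, inv_mul_cancel_left₀ hμ]
  rw [h2] at h1
  convert! h1 using 1
  rw [show β + 1 - 2 = β - 1 by ring]
  ring

end IsCenteredCurve

/-- Dirichlet solutions of the Sturm–Liouville system come from the zeros of `J_ν`. -/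
theorem IsSturmPair.exists_eq_bessel {ν q κ : ℝ} {U H : ℝ → ℝ} (hν : 0 < ν) (hν1 : ν < 1)
    (hq : q = 1 / ν) (h : IsSturmPair q κ U H) (hU : U 1 = 0)
    (hne : ∃ t ∈ Icc (0 : ℝ) 1, H t ≠ 0) :
    ∃ k c, κ = besselZero ν k ^ 2 * q ^ 2 / 4 ∧
      ∀ t ∈ Icc (0 : ℝ) 1, H t = c * besselEntire (ν - 1) (besselZero ν k ^ 2 * t ^ q) := by
  have hq1 : 1 < q := by rw [hq, lt_div_iff₀ hν, one_mul]; exact hν1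
  have hy : κ = (4 * κ / q ^ 2) * q ^ 2 / 4 := by field_simp
  -- The parameter y = 4κ/q² gives the Bessel pair the same κ. The Wronskian at 1 then reads ν
  -- G_ν(y) H(1) = 0.
  have hB := isSturmPair_bessel hν hq (4 * κ / q ^ 2)
  rw [← hy] at hB
  have hH1 : H 1 ≠ 0 := fun hH1 => by
    obtain ⟨t, ht, hne⟩ := hne
    exact hne (h.snd_eq_zero hq1 hU hH1 t ht)
  have hw := h.wronskian hB
  simp only [hU, zero_mul, Real.one_rpow, mul_one] at hw
  have hz : besselEntire ν (4 * κ / q ^ 2) = 0 := by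
    have := (mul_eq_zero.1 hw.symm).resolve_right hH1
    exact (mul_eq_zero.1 this).resolve_left hν.ne'
  obtain ⟨k, hk⟩ := exists_besselZero_sq_eq hν hν1 hz
  have hp := besselEntire_sub_one_ne_zero hν hν1 hz
  refine ⟨k, H 1 / besselEntire (ν - 1) (4 * κ / q ^ 2), by rw [hk]; exact hy, fun t ht => ?_⟩
  -- Subtracting this multiple of the Bessel pair makes both components vanish at 1.
  have := (h.sub_const_mul hB (H 1 / besselEntire (ν - 1) (4 * κ / q ^ 2))).snd_eq_zero hq1
    (by simp [hU, hz]) (by simp; field_simp; simp) t ht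
  rw [hk]
  linarith

/-! ### The eigenfunctions -/

/-- The eigenfunction `e_k`, up to the numbering from `0`. -/
noncomputable def besselEigenfun (ν : ℝ) (k : ℕ) (t : ℝ) : ℝ :=
  (√ν * besselEntire (ν - 1) (besselZero ν k ^ 2))⁻¹ *
    besselEntire (ν - 1) (besselZero ν k ^ 2 * t ^ (1 / ν))

section Eigenfun

variable {ν : ℝ}

/-- The powers of t cancel, since (ν-1)/(2ν) + 1/(2ν) - 1/2 = 0; this exhibits the continuous
extension to t = 0. -/
theorem besselEigenfun_eq (hν : 0 < ν) (hν1 : ν < 1) (k : ℕ) {t : ℝ} (ht : 0 < t) :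
    besselEigenfun ν k t = t ^ (1 / (2 * ν) - 1 / 2) *
      (besselJ (ν - 1) (besselZero ν k * t ^ (1 / (2 * ν))) /
        (√ν * besselJ (ν - 1) (besselZero ν k))) := by
  have hz := besselZero_pos hν hν1 k
  have hp := besselEntire_sub_one_ne_zero hν hν1 (besselEntire_besselZero hν hν1 k)
  have ht' : 0 < t ^ (1 / (2 * ν)) := Real.rpow_pos_of_pos ht _
  have h1 : (t ^ (1 / (2 * ν))) ^ 2 = t ^ (1 / ν) := by
    rw [← Real.rpow_natCast, ← Real.rpow_mul ht.le]
    congr 1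
    push_cast
    field_simp
  have h2 : t ^ (1 / (2 * ν) - 1 / 2) * (t ^ (1 / (2 * ν))) ^ (ν - 1) = 1 := by
    rw [← Real.rpow_mul ht.le, ← Real.rpow_add ht]
    convert! Real.rpow_zero t using 2
    field_simp
    ring
  have h3 : (besselZero ν k * t ^ (1 / (2 * ν)) / 2) ^ (ν - 1) =
      (besselZero ν k / 2) ^ (ν - 1) * (t ^ (1 / (2 * ν))) ^ (ν - 1) := by
    rw [← Real.mul_rpow (by positivity) ht'.le]
    congr 1
    ring
  have h4 : (besselZero ν k / 2) ^ (ν - 1) ≠ 0 := (Real.rpow_pos_of_pos (by positivity) _).ne'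
  have h5 : √ν ≠ 0 := (Real.sqrt_pos.2 hν).ne'
  rw [besselJ_eq, besselJ_eq, h3, mul_pow, h1, besselEigenfun]
  generalize t ^ (1 / (2 * ν) - 1 / 2) = A at h2 ⊢
  generalize (t ^ (1 / (2 * ν))) ^ (ν - 1) = B at h2 ⊢
  field_simp
  rw [mul_assoc, h2, mul_one]

theorem continuous_besselEigenfun (hν : 0 < ν) (k : ℕ) : Continuous (besselEigenfun ν k) := by
  have h1 : Continuous fun t : ℝ => t ^ (1 / ν) := Real.continuous_rpow_const (by positivity)
  have h2 := continuous_besselEntire (show -1 < ν - 1 by linarith)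
  unfold besselEigenfun
  fun_prop

/-- With U(1) = 0 the energy identity reduces to ∫ H² = ν H(1)², which is where the normalization √ν
G_{ν-1}(z²) comes from. -/
theorem integral_besselEigenfun_mul (hν : 0 < ν) (hν1 : ν < 1) (k l : ℕ) :
    ∫ t in Icc (0 : ℝ) 1, besselEigenfun ν k t * besselEigenfun ν l t =
      if k = l then 1 else 0 := by
  have hq1 : 1 < 1 / ν := by rw [lt_div_iff₀ hν, one_mul]; exact hν1
  have hp := fun k => besselEntire_sub_one_ne_zero hν hν1 (besselEntire_besselZero hν hν1 k)
  have h5 : √ν ≠ 0 := (Real.sqrt_pos.2 hν).ne'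
  have hfac : ∀ t, besselEigenfun ν k t * besselEigenfun ν l t =
      ((√ν * besselEntire (ν - 1) (besselZero ν k ^ 2))⁻¹ *
        (√ν * besselEntire (ν - 1) (besselZero ν l ^ 2))⁻¹) *
      (besselEntire (ν - 1) (besselZero ν k ^ 2 * t ^ (1 / ν)) *
        besselEntire (ν - 1) (besselZero ν l ^ 2 * t ^ (1 / ν))) := fun t => by
    unfold besselEigenfun
    ring
  simp_rw [hfac]
  rw [integral_const_mul, integral_Icc_eq_intervalIntegral]
  split_ifs with h
  · subst h
    have h1 := (isSturmPair_bessel hν rfl (besselZero ν k ^ 2)).integral_sq hq1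
    simp only [mul_one, Real.one_rpow, besselEntire_besselZero hν hν1, mul_zero, zero_mul,
      ne_eq, OfNat.ofNat_ne_zero, not_false_eq_true, zero_pow, add_zero] at h1
    simp_rw [← sq]
    have h2 : ∫ t in (0 : ℝ)..1, besselEntire (ν - 1) (besselZero ν k ^ 2 * t ^ (1 / ν)) ^ 2 =
        ν * besselEntire (ν - 1) (besselZero ν k ^ 2) ^ 2 := by
      rw [← h1]; field_simp
    have := hp k
    rw [h2, inv_pow, mul_pow, Real.sq_sqrt hν.le]
    field_simp
  · have h1 := (isSturmPair_bessel hν rfl (besselZero ν k ^ 2)).integral_mul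
      (isSturmPair_bessel hν rfl (besselZero ν l ^ 2))
    simp only [mul_one, Real.one_rpow, besselEntire_besselZero hν hν1, mul_zero, zero_mul,
      sub_zero] at h1
    rw [(mul_eq_zero.1 h1).resolve_left, mul_zero]
    have hne : besselZero ν k ≠ besselZero ν l := (besselZero_strictMono hν hν1).injective.ne h
    have hne' : besselZero ν k ^ 2 ≠ besselZero ν l ^ 2 := fun h' =>
      hne ((sq_eq_sq₀ (besselZero_pos hν hν1 k).le (besselZero_pos hν hν1 l).le).1 h')
    have : besselZero ν k ^ 2 - besselZero ν l ^ 2 ≠ 0 := sub_ne_zero.2 hne'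
    rw [show besselZero ν k ^ 2 * (1 / ν) ^ 2 / 4 - besselZero ν l ^ 2 * (1 / ν) ^ 2 / 4 =
      (besselZero ν k ^ 2 - besselZero ν l ^ 2) * ((1 / ν) ^ 2 / 4) by ring]
    positivity

theorem fredholm_besselEigenfun [CompleteSpace E] (hν : 0 < ν) (hν1 : ν < 1) (hβ : β + 1 = 1 / ν)
    (hφ : IsCenteredCurve β a φ) (k : ℕ) {t : ℝ} (ht : t ∈ Icc (0 : ℝ) 1) :
    fredholm (gramKernel φ) (besselEigenfun ν k) t =
      (2 * ν / besselZero ν k) ^ 2 * besselEigenfun ν k t := by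
  have hz := besselZero_pos hν hν1 k
  have h1 : Continuous fun t : ℝ => t ^ (1 / ν) := Real.continuous_rpow_const (by positivity)
  have h2 := continuous_besselEntire (show -1 < ν - 1 by linarith)
  have hB := isSturmPair_bessel hν rfl (besselZero ν k ^ 2)
  rw [← hβ] at hB
  have := hφ.fredholm_eq_of_isSturmPair (by rw [hβ]; positivity) hB (by rw [hβ]; fun_prop)
    (by simp [besselEntire_besselZero hν hν1]) t ht
  rw [hβ] at this
  have hlin : fredholm (gramKernel φ) (besselEigenfun ν k) t =
      (√ν * besselEntire (ν - 1) (besselZero ν k ^ 2))⁻¹ * fredholm (gramKernel φ)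
        (fun t => besselEntire (ν - 1) (besselZero ν k ^ 2 * t ^ (1 / ν))) t := by
    unfold fredholm besselEigenfun
    rw [← integral_const_mul]
    congr 1
    funext s
    ring
  rw [hlin, this, besselEigenfun]
  have e1 : (besselZero ν k ^ 2 * (1 / ν) ^ 2 / 4)⁻¹ = (2 * ν / besselZero ν k) ^ 2 := by
    field_simp
    norm_num
  rw [e1]
  ring

theorem exists_eq_besselEigenfun [CompleteSpace E] (hν : 0 < ν) (hν1 : ν < 1) (hβ : β + 1 = 1 / ν)
    (hφ : IsCenteredCurve β a φ) {μ : ℝ} {h : ℝ → ℝ} (hμ : μ ≠ 0) (hh : Continuous h)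
    (heig : ∀ t, fredholm (gramKernel φ) h t = μ * h t)
    (hne : ∃ t ∈ Icc (0 : ℝ) 1, h t ≠ 0) :
    ∃ k c, ∀ t ∈ Icc (0 : ℝ) 1, h t = c * besselEigenfun ν k t := by
  obtain ⟨hS, hU⟩ := hφ.isSturmPair_of_fredholm_eq hμ hh heig
  obtain ⟨k, c, -, hc⟩ := hS.exists_eq_bessel hν hν1 hβ hU hne
  have hp := besselEntire_sub_one_ne_zero hν hν1 (besselEntire_besselZero hν hν1 k)
  have h5 : √ν ≠ 0 := (Real.sqrt_pos.2 hν).ne'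
  refine ⟨k, c * (√ν * besselEntire (ν - 1) (besselZero ν k ^ 2)), fun t ht => ?_⟩
  rw [hc t ht, besselEigenfun, hβ]
  field_simp

end Eigenfun

end Kernel

/-! ### Gaussian subspaces of `L²` -/

section GaussianSubspace

variable {Ω : Type*} [MeasurableSpace Ω] {P : Measure Ω}

theorem norm_sq_eq_integral_sq (f : Lp ℝ 2 P) : ‖f‖ ^ 2 = ∫ ω, f ω ^ 2 ∂P := by
  rw [← real_inner_self_eq_norm_sq, L2.inner_def]
  simp [sq]

theorem variance_eq_norm_sq {f : Lp ℝ 2 P} (hf : ∫ ω, f ω ∂P = 0) {X : Ω → ℝ} (hX : X =ᵐ[P] f) :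
    Var[X; P] = ‖f‖ ^ 2 := by
  rw [variance_congr hX, variance_of_integral_eq_zero (Lp.aestronglyMeasurable f).aemeasurable hf,
    norm_sq_eq_integral_sq]

section Pi

variable {ι : Type*} [Fintype ι] {X : ι → Ω → ℝ} {f : ι → Lp ℝ 2 P}

theorem dual_pi_apply {ι : Type*} [Fintype ι] [DecidableEq ι] (L : StrongDual ℝ (ι → ℝ)) (x : ι → ℝ) :
    L x = ∑ i, L (Pi.single i 1) * x i := by
  conv_lhs => rw [← Finset.univ_sum_single x]
  rw [map_sum]
  refine Finset.sum_congr rfl fun i _ => ?_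
  rw [show (Pi.single i (x i) : ι → ℝ) = x i • Pi.single i 1 by simp [← Pi.single_smul],
    map_smul, smul_eq_mul, mul_comm]

theorem dual_comp_ae_eq [DecidableEq ι] (hX : ∀ i, X i =ᵐ[P] f i) (L : StrongDual ℝ (ι → ℝ)) :
    (fun ω => L fun i => X i ω) =ᵐ[P] (∑ i, L (Pi.single i 1) • f i : Lp ℝ 2 P) := by
  refine EventuallyEq.symm ((Lp.coeFn_finsetSum _ _).trans ?_)
  have h : ∀ᵐ ω ∂P, ∀ i, (L (Pi.single i 1) • f i : Lp ℝ 2 P) ω = L (Pi.single i 1) * X i ω := by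
    rw [ae_all_iff]
    intro i
    filter_upwards [Lp.coeFn_smul (L (Pi.single i 1)) (f i), hX i] with ω h1 h2
    rw [h1, Pi.smul_apply, h2, smul_eq_mul]
  filter_upwards [h] with ω hω
  rw [Finset.sum_apply, dual_pi_apply L]
  exact Finset.sum_congr rfl fun i _ => hω i

theorem aemeasurable_pi_of_ae_eq (hX : ∀ i, X i =ᵐ[P] f i) :
    AEMeasurable (fun ω i => X i ω) P :=
  aemeasurable_pi_iff.2 fun i => (Lp.aestronglyMeasurable (f i)).aemeasurable.congr (hX i).symm

end Pi

variable [IsProbabilityMeasure P]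

theorem integrable_coeFn_L2 (f : Lp ℝ 2 P) : Integrable f P :=
  (Lp.memLp f).integrable one_le_two

theorem integral_abs_le_norm (f : Lp ℝ 2 P) : ∫ ω, |f ω| ∂P ≤ ‖f‖ := by
  have h1 : eLpNorm f 1 P ≤ eLpNorm f 2 P :=
    eLpNorm_le_eLpNorm_of_exponent_le one_le_two (Lp.aestronglyMeasurable f)
  have h2 : ∫ ω, |f ω| ∂P = (eLpNorm f 1 P).toReal := by
    rw [eLpNorm_one_eq_lintegral_enorm, ← integral_norm_eq_lintegral_enorm
      (Lp.aestronglyMeasurable f)]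
    simp
  rw [h2, Lp.norm_def]
  exact ENNReal.toReal_mono (Lp.eLpNorm_ne_top f) h1

/-- The element `f` of `L²` has the centered normal law of variance `‖f‖²`. -/
def IsCenteredGaussian (f : Lp ℝ 2 P) : Prop :=
  ∫ ω, f ω ∂P = 0 ∧
    ∫ ω, Complex.exp (f ω * Complex.I) ∂P = Complex.exp (-((‖f‖ ^ 2 : ℝ) : ℂ) / 2)

theorem integrable_cexp_mul_I {f : Ω → ℝ} (hf : AEStronglyMeasurable f P) :
    Integrable (fun ω => Complex.exp (f ω * Complex.I)) P := by
  refine Integrable.of_bound (C := 1) ?_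
    (Eventually.of_forall fun ω => (Complex.norm_exp_ofReal_mul_I _).le)
  have hc : Continuous fun x : ℝ => Complex.exp (x * Complex.I) := by fun_prop
  exact hc.comp_aestronglyMeasurable hf

theorem norm_cexp_mul_I_sub_le (a b : ℝ) :
    ‖Complex.exp (a * Complex.I) - Complex.exp (b * Complex.I)‖ ≤ |a - b| := by
  have h : Complex.exp (a * Complex.I) - Complex.exp (b * Complex.I) =
      Complex.exp (b * Complex.I) * (Complex.exp (Complex.I * ((a - b : ℝ) : ℂ)) - 1) := by
    rw [mul_sub, ← Complex.exp_add, mul_one]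
    congr 2
    push_cast
    ring
  rw [h, norm_mul, Complex.norm_exp_ofReal_mul_I, one_mul]
  exact Real.norm_exp_I_mul_ofReal_sub_one_le

/-- The mean and the characteristic function at 1 are 1-Lipschitz in the L² norm, by |e^{ia} -
e^{ib}| ≤ |a - b| and L¹ ≤ L². -/
theorem isClosed_isCenteredGaussian : IsClosed {f : Lp ℝ 2 P | IsCenteredGaussian f} := by
  have hdist : ∀ f g : Lp ℝ 2 P, ∫ ω, |f ω - g ω| ∂P ≤ dist f g := fun f g => by
    rw [dist_eq_norm]
    refine (integral_abs_le_norm (f - g)).trans' (le_of_eq (integral_congr_ae ?_))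
    filter_upwards [Lp.coeFn_sub f g] with ω hω
    rw [hω, Pi.sub_apply]
  have hint : ∀ f g : Lp ℝ 2 P, Integrable (fun ω => |f ω - g ω|) P := fun f g =>
    ((integrable_coeFn_L2 f).sub (integrable_coeFn_L2 g)).abs
  have h1 : Continuous fun f : Lp ℝ 2 P => ∫ ω, f ω ∂P := by
    refine (LipschitzWith.of_dist_le_mul (K := 1) fun f g => ?_).continuous
    rw [NNReal.coe_one, one_mul, dist_eq_norm,
      ← integral_sub (integrable_coeFn_L2 f) (integrable_coeFn_L2 g)]
    exact (norm_integral_le_integral_norm _).trans (hdist f g)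
  have h2 : Continuous fun f : Lp ℝ 2 P => ∫ ω, Complex.exp (f ω * Complex.I) ∂P := by
    refine (LipschitzWith.of_dist_le_mul (K := 1) fun f g => ?_).continuous
    rw [NNReal.coe_one, one_mul, dist_eq_norm,
      ← integral_sub (integrable_cexp_mul_I (Lp.aestronglyMeasurable f))
        (integrable_cexp_mul_I (Lp.aestronglyMeasurable g))]
    refine (norm_integral_le_of_norm_le (hint f g) (Eventually.of_forall fun ω => ?_)).trans
      (hdist f g)
    exact norm_cexp_mul_I_sub_le _ _
  exact (isClosed_eq h1 continuous_const).inter (isClosed_eq h2 (by fun_prop))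

omit [IsProbabilityMeasure P] in
theorem IsCenteredGaussian.of_hasGaussianLaw {f : Lp ℝ 2 P} (hf : HasGaussianLaw f P)
    (h0 : ∫ ω, f ω ∂P = 0) : IsCenteredGaussian f := by
  refine ⟨h0, ?_⟩
  have h := hf.charFun_map_eq 1
  have hm : AEMeasurable f P := (Lp.aestronglyMeasurable f).aemeasurable
  rw [charFun_apply, integral_map hm (by fun_prop)] at h
  simp only [RCLike.inner_apply, conj_trivial, mul_one, one_mul] at h
  rw [h, h0, variance_eq_norm_sq h0 ae_eq_rfl]
  congr 1
  push_cast
  ring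

/-- The closed span of a centered Gaussian process consists of centered Gaussian variables. -/
theorem isCenteredGaussian_of_mem_closure_span {ι : Type*} {X : ι → Ω → ℝ}
    (hX : IsGaussianProcess X P) (h0 : ∀ i, ∫ ω, X i ω ∂P = 0) {φ : ι → Lp ℝ 2 P}
    (hφ : ∀ i, φ i =ᵐ[P] X i) {f : Lp ℝ 2 P}
    (hf : f ∈ (Submodule.span ℝ (range φ)).topologicalClosure) : IsCenteredGaussian f := by
  refine closure_minimal (fun f hf => ?_) isClosed_isCenteredGaussian hf
  obtain ⟨c, rfl⟩ := Finsupp.mem_span_range_iff_exists_finsupp.1 hf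
  have hsum : (c.sum fun i a => a • φ i : Lp ℝ 2 P) =ᵐ[P] fun ω => ∑ i ∈ c.support, c i • X i ω := by
    unfold Finsupp.sum
    refine (Lp.coeFn_finsetSum _ _).trans ?_
    have h : ∀ᵐ ω ∂P, ∀ i ∈ c.support, (c i • φ i : Lp ℝ 2 P) ω = c i • X i ω := by
      rw [Filter.eventually_all_finset]
      intro i _
      filter_upwards [Lp.coeFn_smul (c i) (φ i), hφ i] with ω h1 h2
      rw [h1, Pi.smul_apply, h2]
    filter_upwards [h] with ω hω
    rw [Finset.sum_apply]
    exact Finset.sum_congr rfl fun i hi => hω i hi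
  refine .of_hasGaussianLaw (((hX.smul c).hasGaussianLaw_fun_sum (I := c.support)).congr hsum.symm)
    ?_
  rw [integral_congr_ae hsum, integral_finsetSum]
  · refine Finset.sum_eq_zero fun i _ => ?_
    rw [integral_smul, h0, smul_zero]
  · exact fun i _ => ((hX.hasGaussianLaw_eval i).integrable).smul (c i)

variable {ι : Type*} [Fintype ι] {X : ι → Ω → ℝ} {f : ι → Lp ℝ 2 P} {G : Submodule ℝ (Lp ℝ 2 P)}

-- The characteristic function at frequency 1 suffices: every linear functional of the vector is
-- again an element of the subspace G.
omit [IsProbabilityMeasure P] in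
theorem charFunDual_map_of_isCenteredGaussian [DecidableEq ι]
    (hG : ∀ g ∈ G, IsCenteredGaussian g) (hf : ∀ i, f i ∈ G) (hX : ∀ i, X i =ᵐ[P] f i)
    (L : StrongDual ℝ (ι → ℝ)) :
    charFunDual (P.map fun ω i => X i ω) L =
      Complex.exp (-((‖∑ i, L (Pi.single i 1) • f i‖ ^ 2 : ℝ) : ℂ) / 2) := by
  rw [charFunDual_apply, integral_map (aemeasurable_pi_of_ae_eq hX) (by fun_prop),
    ← (hG _ (G.sum_mem fun i _ => G.smul_mem _ (hf i))).2]
  refine integral_congr_ae ?_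
  filter_upwards [dual_comp_ae_eq hX L] with ω hω
  rw [hω]

theorem hasGaussianLaw_pi_of_isCenteredGaussian
    (hG : ∀ g ∈ G, IsCenteredGaussian g) (hf : ∀ i, f i ∈ G) (hX : ∀ i, X i =ᵐ[P] f i) :
    HasGaussianLaw (fun ω i => X i ω) P := by
  classical
  rw [hasGaussianLaw_iff_charFunDual_map_eq (aemeasurable_pi_of_ae_eq hX)]
  intro L
  have hL := dual_comp_ae_eq hX L
  have h0 := (hG _ (G.sum_mem (t := Finset.univ) fun i _ => G.smul_mem (L (Pi.single i 1)) (hf i))).1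
  rw [charFunDual_map_of_isCenteredGaussian hG hf hX]
  simp only [Function.comp_def]
  rw [integral_congr_ae hL, h0, variance_eq_norm_sq h0 hL]
  congr 1
  push_cast
  ring

/-- Finite-dimensional laws in Gaussian subspaces are determined by the Gram matrix. -/
theorem map_eq_map_of_inner_eq {Ω' : Type*} [MeasurableSpace Ω'] {P' : Measure Ω'}
    [IsProbabilityMeasure P'] {Y : ι → Ω' → ℝ} {g : ι → Lp ℝ 2 P'} {G' : Submodule ℝ (Lp ℝ 2 P')}
    (hG : ∀ g ∈ G, IsCenteredGaussian g) (hf : ∀ i, f i ∈ G) (hX : ∀ i, X i =ᵐ[P] f i)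
    (hG' : ∀ g ∈ G', IsCenteredGaussian g) (hg : ∀ i, g i ∈ G') (hY : ∀ i, Y i =ᵐ[P'] g i)
    (hfg : ∀ i j, inner ℝ (f i) (f j) = inner ℝ (g i) (g j)) :
    (P.map fun ω i => X i ω) = P'.map fun ω i => Y i ω := by
  classical
  have := Measure.isProbabilityMeasure_map (aemeasurable_pi_of_ae_eq hX)
  have := Measure.isProbabilityMeasure_map (aemeasurable_pi_of_ae_eq hY)
  refine Measure.ext_of_charFunDual (funext fun L => ?_)
  rw [charFunDual_map_of_isCenteredGaussian hG hf hX,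
    charFunDual_map_of_isCenteredGaussian hG' hg hY]
  congr 4
  rw [← real_inner_self_eq_norm_sq, ← real_inner_self_eq_norm_sq]
  simp_rw [sum_inner, inner_sum, real_inner_smul_left, real_inner_smul_right, hfg]

end GaussianSubspace

/-! ### Gaussian series -/

section GaussianSeries

theorem inner_eq_integral_mul {Ω : Type*} [MeasurableSpace Ω] {P : Measure Ω} {f g : Lp ℝ 2 P}
    {X Y : Ω → ℝ} (hX : X =ᵐ[P] f) (hY : Y =ᵐ[P] g) : inner ℝ f g = ∫ ω, X ω * Y ω ∂P := by
  rw [L2.inner_def]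
  refine integral_congr_ae ?_
  filter_upwards [hX, hY] with ω h1 h2
  simp [h1, h2, mul_comm]

/-- An expansion `K(s,t) = ∑ c_k(s) c_k(t)` realizes `K` as a Gram kernel in the closed span of
any orthonormal sequence. -/
theorem exists_hasSum_smul_of_orthonormal {E : Type*} [NormedAddCommGroup E]
    [InnerProductSpace ℝ E] [CompleteSpace E] {f : ℕ → E} (hf : Orthonormal ℝ f) {I : Set ℝ}
    {c : ℕ → ℝ → ℝ} {K : ℝ → ℝ → ℝ}
    (hK : ∀ s ∈ I, ∀ t ∈ I, HasSum (fun k => c k s * c k t) (K s t)) :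
    ∃ y : ℝ → E, (∀ t ∈ I, HasSum (fun k => c k t • f k) (y t)) ∧
      (∀ s ∈ I, ∀ t ∈ I, inner ℝ (y s) (y t) = K s t) ∧
      ∀ t, y t ∈ (Submodule.span ℝ (range f)).topologicalClosure := by
  have hsum : ∀ t ∈ I, Summable fun k => c k t • f k := fun t ht => by
    refine (hf.orthogonalFamily.summable_iff_norm_sq_summable fun k => c k t).2 ?_
    simpa [sq] using (hK t ht t ht).summable
  have hy : ∀ t ∈ I, HasSum (fun k => c k t • f k) (∑' k, c k t • f k) :=
    fun t ht => (hsum t ht).hasSum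
  refine ⟨fun t => ∑' k, c k t • f k, hy, fun s hs t ht => ?_, fun t => ?_⟩
  · have hin : ∀ t ∈ I, ∀ k, inner ℝ (f k) (∑' k, c k t • f k) = c k t := fun t ht k => by
      refine HasSum.unique ((innerSL ℝ (f k)).hasSum (hy t ht)) ?_
      convert! hasSum_ite_eq k (c k t) using 2 with l
      rw [innerSL_apply_apply, real_inner_smul_right, orthonormal_iff_ite.1 hf]
      by_cases h : k = l <;> simp [h, eq_comm]
    refine HasSum.unique ((innerSL ℝ _).hasSum (hy t ht)) ?_
    convert! hK s hs t ht using 2 with k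
    rw [innerSL_apply_apply, real_inner_smul_right, real_inner_comm, hin s hs k, mul_comm]
  · by_cases h : Summable fun k => c k t • f k
    · refine (Submodule.isClosed_topologicalClosure _).mem_of_tendsto h.hasSum
        (Eventually.of_forall fun s => Submodule.sum_mem _ fun k _ => ?_)
      exact Submodule.le_topologicalClosure _
        (Submodule.smul_mem _ _ (Submodule.subset_span (mem_range_self k)))
    · simp only [tsum_eq_zero_of_not_summable h]
      exact Submodule.zero_mem _

variable {Ω : Type*} [MeasurableSpace Ω] {P : Measure Ω} {ξ : ℕ → Ω → ℝ}

theorem isGaussianProcess_of_iIndepFun (hξ : iIndepFun ξ P) (hg : ∀ k, HasGaussianLaw (ξ k) P) :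
    IsGaussianProcess ξ P where
  hasGaussianLaw I := iIndepFun.hasGaussianLaw (X := fun i : I => ξ i) (fun i => hg i)
    (hξ.precomp Subtype.val_injective)

theorem integral_eq_zero_of_hasLaw {X : Ω → ℝ} {v : ℝ≥0} (hX : HasLaw X (gaussianReal 0 v) P) :
    ∫ ω, X ω ∂P = 0 := by
  rw [hX.integral_eq, integral_id_gaussianReal]

variable [IsProbabilityMeasure P]

theorem orthonormal_toLp_of_iIndepFun (hξ : iIndepFun ξ P)
    (hlaw : ∀ k, HasLaw (ξ k) (gaussianReal 0 1) P) (hL : ∀ k, MemLp (ξ k) 2 P) :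
    Orthonormal ℝ fun k => (hL k).toLp (ξ k) := by
  rw [orthonormal_iff_ite]
  intro k l
  rw [inner_eq_integral_mul (hL k).coeFn_toLp.symm (hL l).coeFn_toLp.symm]
  have h0 := fun k => integral_eq_zero_of_hasLaw (hlaw k)
  split_ifs with h
  · subst h
    have h1 := (hlaw k).variance_eq
    rw [variance_of_integral_eq_zero (hlaw k).aemeasurable (h0 k), variance_id_gaussianReal] at h1
    simpa [sq] using h1
  · have h1 := (hξ.indepFun h).covariance_eq_zero (hL k) (hL l)
    rw [covariance_eq_sub (hL k) (hL l), h0 k, zero_mul, sub_zero] at h1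
    exact h1

/-- The law part of a Karhunen–Loève expansion. -/
theorem exists_series_identDistrib {Ω' : Type*} [MeasurableSpace Ω'] {P' : Measure Ω'}
    [IsProbabilityMeasure P'] {X : ℝ → Ω' → ℝ} {f : ℝ → Lp ℝ 2 P'} (hX : ∀ t, X t =ᵐ[P'] f t)
    {G : Submodule ℝ (Lp ℝ 2 P')} (hG : ∀ g ∈ G, IsCenteredGaussian g) (hf : ∀ t, f t ∈ G)
    {lam : ℕ → ℝ} {e : ℕ → ℝ → ℝ} (hlam : ∀ k, 0 ≤ lam k) {I : Set ℝ}
    (hK : ∀ s ∈ I, ∀ t ∈ I, HasSum (fun k => lam k * e k s * e k t) (inner ℝ (f s) (f t)))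
    (hξ : iIndepFun ξ P) (hlaw : ∀ k, HasLaw (ξ k) (gaussianReal 0 1) P) :
    ∃ Y : ℝ → Ω → ℝ,
      (∀ t ∈ I, MemLp (Y t) 2 P ∧
        Tendsto
          (fun n : ℕ => ∫ ω, (Y t ω - ∑ k ∈ Finset.range n, ξ k ω * √(lam k) * e k t) ^ 2 ∂P)
          atTop (𝓝 0)) ∧
      ∀ J : Finset ℝ, (J : Set ℝ) ⊆ I →
        IdentDistrib (fun ω (t : J) => X t ω) (fun ω (t : J) => Y t ω) P' P := by
  have hgl : ∀ k, HasGaussianLaw (ξ k) P := fun k => (hlaw k).hasGaussianLaw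
  have hL : ∀ k, MemLp (ξ k) 2 P := fun k => (hgl k).memLp_two
  obtain ⟨y, hy, hyK, hyG⟩ := exists_hasSum_smul_of_orthonormal
    (orthonormal_toLp_of_iIndepFun hξ hlaw hL) (c := fun k t => √(lam k) * e k t) (I := I)
    (K := fun s t => inner ℝ (f s) (f t)) (fun s hs t ht => by
      convert! hK s hs t ht using 2 with k
      linear_combination (e k s * e k t) * Real.mul_self_sqrt (hlam k))
  refine ⟨fun t => y t, fun t ht => ⟨Lp.memLp _, ?_⟩, fun J hJ => ⟨?_, ?_, ?_⟩⟩
  · have h1 : Tendsto (fun n => ‖y t - ∑ k ∈ Finset.range n,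
        (√(lam k) * e k t) • (hL k).toLp (ξ k)‖ ^ 2) atTop (𝓝 0) := by
      have := (tendsto_const_nhds (x := y t)).sub (hy t ht).tendsto_sum_nat
      rw [sub_self] at this
      simpa using (this.norm.pow 2)
    refine h1.congr fun n => ?_
    rw [norm_sq_eq_integral_sq]
    refine integral_congr_ae ?_
    have h2 : ∀ᵐ ω ∂P, ∀ k, ((√(lam k) * e k t) • (hL k).toLp (ξ k) : Lp ℝ 2 P) ω =
        ξ k ω * √(lam k) * e k t := by
      rw [ae_all_iff]
      intro k
      filter_upwards [Lp.coeFn_smul (√(lam k) * e k t) ((hL k).toLp (ξ k)),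
        (hL k).coeFn_toLp] with ω h3 h4
      rw [h3, Pi.smul_apply, h4, smul_eq_mul]
      ring
    filter_upwards [h2, Lp.coeFn_sub (y t) (∑ k ∈ Finset.range n,
        (√(lam k) * e k t) • (hL k).toLp (ξ k)), Lp.coeFn_finsetSum (Finset.range n)
        fun k => (√(lam k) * e k t) • (hL k).toLp (ξ k)] with ω h3 h4 h5
    rw [h4, Pi.sub_apply, h5, Finset.sum_apply]
    simp_rw [h3]
  · exact aemeasurable_pi_of_ae_eq (f := fun t : J => f t) fun t => hX t
  · exact aemeasurable_pi_of_ae_eq (f := fun t : J => y t) fun t => ae_eq_rfl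
  · refine map_eq_map_of_inner_eq (f := fun t : J => f t) (g := fun t : J => y t) hG
      (fun t => hf t) (fun t => hX t) (fun g hg => ?_) (fun t => hyG t)
      (fun t => ae_eq_rfl) fun s t => (hyK s (hJ s.2) t (hJ t.2)).symm
    exact isCenteredGaussian_of_mem_closure_span (isGaussianProcess_of_iIndepFun hξ hgl)
      (fun k => integral_eq_zero_of_hasLaw (hlaw k)) (fun k => (hL k).coeFn_toLp) hg

end GaussianSeries

/-! ### The weighted Wiener process as a curve in `L²` -/

/-- Riemann sums of a continuous function converge to its integral. -/
theorem tendsto_riemannSum {F : Type*} [NormedAddCommGroup F] [NormedSpace ℝ F]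
    [CompleteSpace F] {f : ℝ → F} (hf : Continuous f) :
    Tendsto (fun n : ℕ => (n : ℝ)⁻¹ • ∑ j ∈ Finset.range n, f (j / n)) atTop
      (𝓝 (∫ u in (0 : ℝ)..1, f u)) := by
  rw [Metric.tendsto_atTop]
  intro ε hε
  have huc := isCompact_Icc.uniformContinuousOn_of_continuous
    (hf.continuousOn (s := Icc (0 : ℝ) 1))
  rw [Metric.uniformContinuousOn_iff_le] at huc
  obtain ⟨δ, hδ, hfδ⟩ := huc (ε / 2) (by positivity)
  obtain ⟨N, hN⟩ := exists_nat_gt (1 / δ)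
  refine ⟨N + 1, fun n hn => ?_⟩
  have hn0 : (0 : ℝ) < n := by exact_mod_cast (Nat.succ_pos N).trans_le hn
  have hnδ : (n : ℝ)⁻¹ ≤ δ := by
    have : (N : ℝ) ≤ n := by exact_mod_cast (Nat.le_succ N).trans hn
    rw [inv_le_comm₀ hn0 hδ, ← one_div]
    linarith
  have hint : ∀ x y, IntervalIntegrable f volume x y := fun x y => hf.intervalIntegrable x y
  have hsplit : ∫ u in (0 : ℝ)..1, f u =
      ∑ j ∈ Finset.range n, ∫ u in ((j : ℝ) / n)..((j + 1 : ℕ) : ℝ) / n, f u := by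
    rw [intervalIntegral.sum_integral_adjacent_intervals (a := fun j : ℕ => (j : ℝ) / n)
      fun k _ => hint _ _]
    simp [hn0.ne']
  have hlen : ∀ j : ℕ, ((j + 1 : ℕ) : ℝ) / n - (j : ℝ) / n = (n : ℝ)⁻¹ := fun j => by
    push_cast; field_simp; ring
  have hconst : (n : ℝ)⁻¹ • ∑ j ∈ Finset.range n, f (j / n) =
      ∑ j ∈ Finset.range n, ∫ _ in ((j : ℝ) / n)..((j + 1 : ℕ) : ℝ) / n, f (j / n) := by
    rw [Finset.smul_sum]
    refine Finset.sum_congr rfl fun j _ => ?_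
    rw [intervalIntegral.integral_const, hlen]
  rw [hsplit, hconst, dist_eq_norm, ← Finset.sum_sub_distrib]
  have hbound : ∀ j ∈ Finset.range n,
      ‖(∫ _ in ((j : ℝ) / n)..((j + 1 : ℕ) : ℝ) / n, f (j / n)) -
        ∫ u in ((j : ℝ) / n)..((j + 1 : ℕ) : ℝ) / n, f u‖ ≤ ε / 2 * (n : ℝ)⁻¹ := fun j hj => by
    rw [← intervalIntegral.integral_sub intervalIntegrable_const (hint _ _)]
    have hle : (j : ℝ) / n ≤ ((j + 1 : ℕ) : ℝ) / n := by
      have := hlen j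
      have : (0 : ℝ) < (n : ℝ)⁻¹ := inv_pos.2 hn0
      linarith
    refine (intervalIntegral.norm_integral_le_of_norm_le_const (C := ε / 2)
      fun u hu => ?_).trans_eq ?_
    · rw [uIoc_of_le hle] at hu
      have h0 : 0 ≤ (j : ℝ) / n := by positivity
      have h1 : ((j + 1 : ℕ) : ℝ) / n ≤ 1 := by
        rw [div_le_one hn0]
        exact_mod_cast Finset.mem_range.1 hj
      rw [← dist_eq_norm]
      refine hfδ _ ⟨h0, hle.trans h1⟩ _ ⟨h0.trans hu.1.le, hu.2.trans h1⟩ ?_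
      rw [dist_comm, Real.dist_eq, abs_of_nonneg (sub_nonneg.2 hu.1.le)]
      have := hlen j
      linarith [hu.2]
    · rw [hlen, abs_of_pos (inv_pos.2 hn0)]
  refine (norm_sum_le_of_le _ hbound).trans_lt ?_
  rw [Finset.sum_const, Finset.card_range, nsmul_eq_mul]
  field_simp
  norm_num

section Wiener

variable {Ω : Type*} [MeasurableSpace Ω] {P : Measure Ω} [IsProbabilityMeasure P]

omit [IsProbabilityMeasure P] in
/-- The integral of a process with continuous paths that is a continuous curve in `L²` is the
integral of the curve. -/
theorem coeFn_integral_ae_eq {X : ℝ → Ω → ℝ} {φ : ℝ → Lp ℝ 2 P} (hφ : Continuous φ)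
    (hX : ∀ t, φ t =ᵐ[P] X t) (hc : ∀ᵐ ω ∂P, Continuous fun t => X t ω) :
    (∫ u in (0 : ℝ)..1, φ u : Lp ℝ 2 P) =ᵐ[P] fun ω => ∫ u in (0 : ℝ)..1, X u ω := by
  -- Riemann sums converge in L² to the integral of the curve, hence almost surely along a
  -- subsequence; pathwise they converge to the integrals of the paths.
  obtain ⟨ns, hns, hlim⟩ :=
    (tendstoInMeasure_of_tendsto_Lp (tendsto_riemannSum hφ)).exists_seq_tendsto_ae
  have hsum : ∀ᵐ ω ∂P, ∀ n : ℕ,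
      ((n : ℝ)⁻¹ • ∑ j ∈ Finset.range n, φ (j / n) : Lp ℝ 2 P) ω =
        (n : ℝ)⁻¹ • ∑ j ∈ Finset.range n, X (j / n) ω := by
    rw [ae_all_iff]
    intro n
    have h : ∀ᵐ ω ∂P, ∀ j : ℕ, φ (j / n) ω = X (j / n) ω := ae_all_iff.2 fun j => hX _
    filter_upwards [h, Lp.coeFn_smul (n : ℝ)⁻¹ (∑ j ∈ Finset.range n, φ (j / n)),
      Lp.coeFn_finsetSum (Finset.range n) fun j : ℕ => φ (j / n)] with ω h1 h2 h3
    rw [h2, Pi.smul_apply, h3, Finset.sum_apply]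
    simp_rw [h1]
  filter_upwards [hlim, hsum, hc] with ω h1 h2 h3
  refine tendsto_nhds_unique h1 ?_
  simp_rw [h2]
  exact (tendsto_riemannSum h3).comp hns.tendsto_atTop

/-- A Wiener process, with the time change `t ↦ t^β`, as a curve in `L²`. -/
theorem exists_wienerCurve {W : ℝ≥0 → Ω → ℝ} (hW : IsPreBrownianReal W P) {β : ℝ} (hβ : 0 < β) :
    ∃ w : ℝ → Lp ℝ 2 P, Continuous w ∧ (∀ t, w t =ᵐ[P] W (t ^ β).toNNReal) ∧
      (∀ s t, 0 ≤ s → 0 ≤ t → inner ℝ (w s) (w t) = min s t ^ β) ∧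
      ∃ G : Submodule ℝ (Lp ℝ 2 P), IsClosed (G : Set (Lp ℝ 2 P)) ∧
        (∀ g ∈ G, IsCenteredGaussian g) ∧ ∀ t, w t ∈ G := by
  have hL : ∀ t, MemLp (W t) 2 P := fun t =>
    (hW.isGaussianProcess.hasGaussianLaw_eval t).memLp_two
  set B : ℝ≥0 → Lp ℝ 2 P := fun t => (hL t).toLp (W t)
  have hB : ∀ t, B t =ᵐ[P] W t := fun t => (hL t).coeFn_toLp
  have hin : ∀ s t, inner ℝ (B s) (B t) = ((min s t : ℝ≥0) : ℝ) := fun s t => by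
    rw [inner_eq_integral_mul (hB s).symm (hB t).symm, ← hW.covariance_eval s t,
      covariance_eq_sub (hL s) (hL t), hW.integral_eval, zero_mul, sub_zero]
    rfl
  have hcont : Continuous B := by
    -- Brownian increments have variance |s - t|.
    have hd : ∀ s t, dist (B s) (B t) = √(dist s t) := fun s t => by
      rw [dist_eq_norm, ← Real.sqrt_sq (norm_nonneg _), norm_sub_sq_real,
        ← real_inner_self_eq_norm_sq, ← real_inner_self_eq_norm_sq, hin, hin, hin, min_self,
        min_self, NNReal.dist_eq]
      congr 1
      rcases le_total s t with h | h
      · have h' : (s : ℝ) ≤ t := h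
        rw [min_eq_left h, abs_of_nonpos (by linarith)]
        ring
      · have h' : (t : ℝ) ≤ s := h
        rw [min_eq_right h, abs_of_nonneg (by linarith)]
        ring
    rw [continuous_iff_continuousAt]
    intro t
    rw [ContinuousAt, tendsto_iff_dist_tendsto_zero]
    simp_rw [hd]
    have : Continuous fun s : ℝ≥0 => √(dist s t) := by fun_prop
    simpa using this.tendsto t
  have hp : Continuous fun t : ℝ => (t ^ β).toNNReal :=
    continuous_real_toNNReal.comp (Real.continuous_rpow_const hβ.le)
  refine ⟨fun t => B (t ^ β).toNNReal, hcont.comp hp, fun t => hB _, fun s t hs ht => ?_,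
    (Submodule.span ℝ (range B)).topologicalClosure, Submodule.isClosed_topologicalClosure _,
    fun g hg => isCenteredGaussian_of_mem_closure_span hW.isGaussianProcess hW.integral_eval hB hg,
    fun t => Submodule.le_topologicalClosure _ (Submodule.subset_span (mem_range_self _))⟩
  rw [hin, NNReal.coe_min, Real.coe_toNNReal _ (Real.rpow_nonneg hs _),
    Real.coe_toNNReal _ (Real.rpow_nonneg ht _)]
  rcases le_total s t with h | h
  · rw [min_eq_left h, min_eq_left (Real.rpow_le_rpow hs h hβ.le)]
  · rw [min_eq_right h, min_eq_right (Real.rpow_le_rpow ht h hβ.le)]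

/-- The weighted mean-centered Wiener process as a centered curve in a Gaussian subspace. -/
theorem exists_isCenteredCurve {W : ℝ≥0 → Ω → ℝ} (hW : IsBrownianReal W P) {γ : ℝ}
    (hγ : -1 / 2 < γ) :
    ∃ (φ : ℝ → Lp ℝ 2 P) (a : ℝ → ℝ) (G : Submodule ℝ (Lp ℝ 2 P)),
      IsCenteredCurve (1 + 2 * γ) a φ ∧ (∀ t, weightedMeanCentered W γ t =ᵐ[P] φ t) ∧
      (∀ g ∈ G, IsCenteredGaussian g) ∧ ∀ t, φ t ∈ G := by
  set β := 1 + 2 * γ with hβdef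
  have hβ : 0 < β := by linarith
  obtain ⟨w, hwc, hwW, hwin, G, hGc, hG, hwG⟩ := exists_wienerCurve hW.toIsPreBrownianReal hβ
  have hp : Continuous fun t : ℝ => (t ^ β).toNNReal :=
    continuous_real_toNNReal.comp (Real.continuous_rpow_const hβ.le)
  set Z : Lp ℝ 2 P := ∫ u in (0 : ℝ)..1, w u with hZ
  have hZae : Z =ᵐ[P] fun ω => ∫ u in (0 : ℝ)..1, W (u ^ β).toNNReal ω :=
    coeFn_integral_ae_eq hwc hwW (hW.cont.mono fun ω h => h.comp hp)
  have hZG : Z ∈ G := by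
    rw [hZ, ← integral_Icc_eq_intervalIntegral]
    exact Convex.integral_mem (s := (G : Set (Lp ℝ 2 P))) G.convex hGc
      (Eventually.of_forall hwG) hwc.continuousOn.integrableOn_Icc
  have hsq : √β * √β = β := Real.mul_self_sqrt hβ.le
  have hsq0 : √β ≠ 0 := (Real.sqrt_pos.2 hβ).ne'
  -- The function a comes from expanding ⟨w(s) - Z, w(t) - Z⟩/β, with ⟨Z, Z⟩/β shared equally
  -- between a(s) and a(t).
  refine ⟨fun t => (1 / √β) • (w t - Z),
    fun t => -inner ℝ (w t) Z / β + inner ℝ Z Z / (2 * β), G, ⟨hβ, by fun_prop, by fun_prop, ?_,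
    fun s hs t ht => ?_⟩, fun t => ?_, hG, fun t => G.smul_mem _ (G.sub_mem (hwG t) hZG)⟩
  · rw [integral_smul, integral_sub hwc.continuousOn.integrableOn_Icc (integrable_const _),
      integral_Icc_eq_intervalIntegral]
    simp [hZ]
  · rw [real_inner_smul_left, real_inner_smul_right, inner_sub_left, inner_sub_right,
      inner_sub_right, hwin s t hs.1 ht.1, real_inner_comm Z (w t), ← mul_assoc,
      show 1 / √β * (1 / √β) = 1 / β by rw [div_mul_div_comm, hsq, one_mul]]
    have := hβ.ne'
    field_simp
    ring
  · filter_upwards [Lp.coeFn_smul (1 / √β) (w t - Z), Lp.coeFn_sub (w t) Z, hwW t, hZae]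
      with ω h1 h2 h3 h4
    rw [h1, Pi.smul_apply, h2, Pi.sub_apply, h3, h4, weightedMeanCentered, smul_eq_mul]

end Wiener

/-! ### The Karhunen–Loève expansion -/

/-- An L² eigenfunction agrees almost everywhere with g = μ⁻¹ T h, which is continuous and satisfies
the eigenvalue equation everywhere. Hence g = c e_k on [0,1] with c ≠ 0, and c is the integral. -/
theorem IsEigenpair.exists_integral_mul_besselEigenfun_ne_zero {E : Type*} [NormedAddCommGroup E]
    [InnerProductSpace ℝ E] [CompleteSpace E] {φ : ℝ → E} {a : ℝ → ℝ} {β ν μ : ℝ} {h : ℝ → ℝ}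
    (hν : 0 < ν) (hν1 : ν < 1) (hβ : β + 1 = 1 / ν) (hφ : IsCenteredCurve β a φ) (hμ : μ ≠ 0)
    (hh : IsEigenpair (gramKernel φ) μ h) :
    ∃ k, ∫ t in Icc (0 : ℝ) 1, h t * besselEigenfun ν k t ≠ 0 := by
  have hi : IntegrableOn h (Icc 0 1) := hh.memLp.integrable one_le_two
  set g : ℝ → ℝ := fun t => μ⁻¹ * fredholm (gramKernel φ) h t with hg
  have hgc : Continuous g :=
    continuous_const.mul (continuous_fredholm_gramKernel hφ.continuous hi)
  have hae : h =ᵐ[volume.restrict (Icc (0 : ℝ) 1)] g := by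
    filter_upwards [hh.eigen] with t ht
    simp only [hg, ht]
    field_simp
  have heig : ∀ t, fredholm (gramKernel φ) g t = μ * g t := fun t => by
    have : fredholm (gramKernel φ) g t = fredholm (gramKernel φ) h t := by
      unfold fredholm
      refine integral_congr_ae ?_
      filter_upwards [hae] with s hs
      rw [hs]
    rw [this, hg]
    field_simp
  have hne : ∃ t ∈ Icc (0 : ℝ) 1, g t ≠ 0 := by
    by_contra! hzero
    refine hh.ne_zero (hae.trans ?_)
    filter_upwards [ae_restrict_mem measurableSet_Icc] with t ht
    exact hzero t ht
  obtain ⟨k, c, hc⟩ := exists_eq_besselEigenfun hν hν1 hβ hφ hμ hgc heig hne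
  refine ⟨k, ?_⟩
  have hint : ∫ t in Icc (0 : ℝ) 1, h t * besselEigenfun ν k t = c := by
    have h1 : ∫ t in Icc (0 : ℝ) 1, h t * besselEigenfun ν k t =
        ∫ t in Icc (0 : ℝ) 1, c * (besselEigenfun ν k t * besselEigenfun ν k t) := by
      refine integral_congr_ae ?_
      filter_upwards [hae, ae_restrict_mem measurableSet_Icc] with t h1 ht
      rw [h1, hc t ht, mul_assoc]
    rw [h1, integral_const_mul, integral_besselEigenfun_mul hν hν1, if_pos rfl, mul_one]
  rw [hint]
  rintro rfl
  obtain ⟨t, ht, hne⟩ := hne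
  exact hne (by rw [hc t ht, zero_mul])

theorem isEigenpair_besselEigenfun {E : Type*} [NormedAddCommGroup E]
    [InnerProductSpace ℝ E] [CompleteSpace E] {φ : ℝ → E} {a : ℝ → ℝ} {β ν : ℝ}
    (hν : 0 < ν) (hν1 : ν < 1) (hβ : β + 1 = 1 / ν) (hφ : IsCenteredCurve β a φ) (k : ℕ) :
    IsEigenpair (gramKernel φ) ((2 * ν / besselZero ν k) ^ 2) (besselEigenfun ν k) where
  memLp := by
    have hc := continuous_besselEigenfun hν k
    obtain ⟨C, hC⟩ := isCompact_Icc.exists_bound_of_continuousOn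
      (hc.continuousOn (s := Icc (0 : ℝ) 1))
    exact MemLp.of_bound hc.aestronglyMeasurable C
      ((ae_restrict_iff' measurableSet_Icc).2 (Eventually.of_forall hC))
  ne_zero h := by
    have h1 := integral_besselEigenfun_mul hν hν1 k k
    rw [if_pos rfl, integral_eq_zero_of_ae] at h1
    · exact zero_ne_one h1
    · filter_upwards [h] with t ht
      simp [ht]
  eigen := by
    filter_upwards [ae_restrict_mem measurableSet_Icc] with t ht
    exact fredholm_besselEigenfun hν hν1 hβ hφ k ht

/-- The Karhunen–Loève expansion of a process given by a centered curve in a Gaussian subspace. -/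
theorem isKLExpansion_of_isCenteredCurve {Ω : Type u} [MeasurableSpace Ω] {P : Measure Ω}
    [IsProbabilityMeasure P] {X : ℝ → Ω → ℝ} {φ : ℝ → Lp ℝ 2 P} {a : ℝ → ℝ} {β ν : ℝ}
    {G : Submodule ℝ (Lp ℝ 2 P)} (hν : 0 < ν) (hν1 : ν < 1) (hβ : β + 1 = 1 / ν)
    (hφ : IsCenteredCurve β a φ) (hX : ∀ t, X t =ᵐ[P] φ t)
    (hG : ∀ g ∈ G, IsCenteredGaussian g) (hφG : ∀ t, φ t ∈ G) :
    IsKLExpansion.{u, v} P X (fun k => (2 * ν / besselZero ν k) ^ 2) (besselEigenfun ν) := by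
  have hK : covKernel P X = gramKernel φ := by
    funext s t
    exact (inner_eq_integral_mul (hX s) (hX t)).symm
  have hcont : Continuous fun p : ℝ × ℝ => gramKernel φ p.1 p.2 := by
    have := hφ.continuous
    unfold gramKernel
    fun_prop
  have hpos := besselZero_pos hν hν1
  have hlam : ∀ k, 0 < (2 * ν / besselZero ν k) ^ 2 := fun k => by
    have := hpos k
    positivity
  refine
    { gaussian := ⟨fun I => hasGaussianLaw_pi_of_isCenteredGaussian (ι := I)
        (f := fun t => φ ((t : Icc (0 : ℝ) 1) : ℝ)) hG (fun t => hφG _) fun t => hX _⟩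
      centered := fun t _ => by rw [integral_congr_ae (hX t), (hG _ (hφG t)).1]
      cov_memLp := ?_
      antitone := fun k l hkl => ?_
      nonneg := fun k => (hlam k).le
      eigenpair := fun k => by
        rw [hK]; exact isEigenpair_besselEigenfun hν hν1 hβ hφ k
      eigen_eq := fun k t ht => by
        rw [hK]; exact fredholm_besselEigenfun hν hν1 hβ hφ k ht
      orthonormal := integral_besselEigenfun_mul hν hν1
      exhaust := fun μ h hμ hh => by
        rw [hK] at hh
        exact hh.exists_integral_mul_besselEigenfun_ne_zero hν hν1 hβ hφ hμ
      law := fun Ω' _ P' _ ξ hξ hlaw => ?_ }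
  · rw [hK]
    have hcpt : IsCompact (Icc (0 : ℝ) 1 ×ˢ Icc (0 : ℝ) 1) := isCompact_Icc.prod isCompact_Icc
    obtain ⟨C, hC⟩ := hcpt.exists_bound_of_continuousOn hcont.continuousOn
    have : IsFiniteMeasure
        ((volume : Measure (ℝ × ℝ)).restrict (Icc (0 : ℝ) 1 ×ˢ Icc (0 : ℝ) 1)) :=
      isFiniteMeasure_restrict.2 hcpt.measure_ne_top
    exact MemLp.of_bound hcont.aestronglyMeasurable C
      ((ae_restrict_iff' (measurableSet_Icc.prod measurableSet_Icc)).2 (Eventually.of_forall hC))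
  · have := hpos k
    have := hpos l
    have := (besselZero_strictMono hν hν1).monotone hkl
    dsimp only
    gcongr
  · exact exists_series_identDistrib hX hG hφG (fun k => (hlam k).le)
      (fun s hs t ht => hasSum_mercer hφ.continuous hlam (continuous_besselEigenfun hν)
        (integral_besselEigenfun_mul hν hν1)
        (fun k t ht => fredholm_besselEigenfun hν hν1 hβ hφ k ht)
        (fun μ h hμ hh heig hne => exists_eq_besselEigenfun hν hν1 hβ hφ hμ hh heig hne) hs ht)
      hξ hlaw

theorem theorem1p3 {Ω : Type u} [MeasurableSpace Ω] (P : Measure Ω) [IsProbabilityMeasure P]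
    (W : ℝ≥0 → Ω → ℝ) (hW : IsBrownianReal W P)
    (γ ν : ℝ) (hγ : -1 / 2 < γ) (hν : ν = 1 / (2 * (1 + γ))) :
    (0 < ν ∧ ν < 1) ∧
    (StrictMono (besselZero ν) ∧
      Set.range (besselZero ν) = {x : ℝ | 0 < x ∧ besselJ ν x = 0}) ∧
    ∃ e : ℕ → ℝ → ℝ,
      (∀ k, ContinuousOn (e k) (Set.Icc 0 1)) ∧
      (∀ k, ∀ t ∈ Set.Ioc (0 : ℝ) 1,
        e k t = t ^ (1 / (2 * ν) - 1 / 2) *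
          (besselJ (ν - 1) (besselZero ν k * t ^ (1 / (2 * ν))) /
            (√ν * besselJ (ν - 1) (besselZero ν k)))) ∧
      IsKLExpansion.{u, v} P (weightedMeanCentered W γ)
        (fun k => (2 * ν / besselZero ν k) ^ 2) e := by
  have h1 : 0 < 1 + γ := by linarith
  have hν0 : 0 < ν := by rw [hν]; positivity
  have hν1 : ν < 1 := by
    rw [hν, div_lt_one (by positivity)]
    linarith
  have hβ : 1 + 2 * γ + 1 = 1 / ν := by
    rw [hν, one_div_one_div]
    ring
  obtain ⟨φ, a, G, hφ, hX, hG, hφG⟩ := exists_isCenteredCurve hW hγ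
  exact ⟨⟨hν0, hν1⟩, ⟨besselZero_strictMono hν0 hν1, range_besselZero hν0 hν1⟩,
    besselEigenfun ν, fun k => (continuous_besselEigenfun hν0 k).continuousOn,
    fun k t ht => besselEigenfun_eq hν0 hν1 k ht.1,
    isKLExpansion_of_isCenteredCurve hν0 hν1 hβ hφ hX hG hφG⟩
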